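/- Let $\alpha,\beta\ge 1$ be integers. The Grushin space $\mathbb G^3_{(\alpha,\beta)}$ is $\mathbb R^3$, with coordinates $(x,y,z)$, equipped with the vector fields $X_1=\partial_x$, $X_2=x^\alpha\partial_y$, $X_3=x^\alpha y^\beta\partial_z$. Its Hamiltonian, in covector coordinates $(u,v,w)$, is $H=\tfrac12\big(u^2+x^{2\alpha}v^2+x^{2\alpha}y^{2\beta}w^2\big)$. A geodesic is the projection $\gamma$ to $\mathbb R^3$ of a solution of Hamilton's equations $q'=\partial H/\partial p$, $p'=-\partial H/\partial q$. Write $\gamma(\cdot\,;p)$ for the geodesic with starting point $q_0$ and initial covector $p$, and $\exp_{q_0}(p)=\gamma(1;p)$, so that $\gamma(t;\lambda_0)=\exp_{q_0}(t\lambda_0)$. A time $t>0$ is conjugate for $\lambda_0$ if $\exp_{q_0}$ has a critical point at $t\lambda_0$, and $t_{\mathrm{con}}\in[0,+\infty]$ is the infimum of the conjugate times ($+\infty$ if there are none). For an integer $a\ge1$ let $\pi_a=2\int_0^1(1-t^{2a})^{-1/2}\,dt$. Let $\sin_a$ be the inverse of $x\mapsto\int_0^x(1-t^{2a})^{-1/2}\,dt$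 on $[0,\pi_a/2]$, extended to $[0,\pi_a]$ by $\sin_a(s)=\sin_a(\pi_a-s)$, then to an odd function on $[-\pi_a,\pi_a]$, and then $2\pi_a$-periodically to $\mathbb R$. Let $\cos_a=\sin_a'$ and $\rho_a(s)=|s|^{a-1}s$. Let $q_0=(x_0,y_0,z_0)$ be a Riemannian point (the fields $X_1,X_2,X_3$ span the tangent space at $q_0$; equivalently $x_0,y_0\neq0$), and let $\lambda_0=(u_0,v_0,w_0)$ satisfy $H(q_0,\lambda_0)=\tfrac12$. Then $\lambda_0$ has generalized spherical coordinates $(\phi_1,\phi_2)\in[0,\pi_\alpha]\times[0,2\pi_\beta)$, i.e. $$u_0=\cos_\alpha\phi_1,\qquad v_0=\rho_\alpha\!\Big(\frac{\sin_\alpha\phi_1}{x_0}\Big)\cos_\beta\phi_2,\qquad w_0=\rho_\alpha\!\Big(\frac{\sin_\alpha\phi_1}{x_0}\Big)\rho_\beta\!\Big(\frac{\sin_\beta\phi_2}{y_0}\Big).$$ For any such $(\phi_1,\phi_2)$ put $\omega_1=\frac{\sin_\alpha\phi_1}{x_0}$ and $\omega_2=\frac{\sin_\beta\phi_2}{y_0}\,\rho_\alpha\!\big(\frac{\sin_\alpha\phi_1}{x_0}\big)$.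 Let $x(s)$ be the first coordinate of $\exp_{q_0}(s\lambda_0)$, and define $$\tau_1=\begin{cases}\pi_\alpha/|\omega_1|,&\lambda_0\ne(\pm1,0,0),\\ +\infty,&\lambda_0=(\pm1,0,0),\end{cases}\qquad \tau_2=\begin{cases}\min\{t>0:\ |\omega_2|\int_0^t x(s)^{2\alpha}\,ds=\pi_\beta\},&w_0\neq0,\\ +\infty,&w_0=0,\end{cases}$$ where the minimum is attained, and put $\tau=\min\{\tau_1,\tau_2\}$. **Lemma.** The geodesic $t\mapsto\exp_{q_0}(t\lambda_0)$ exists for all times. It has no conjugate time $t<\tau$: for $0<t<\tau$ the map $\exp_{q_0}$ is differentiable at $t\lambda_0$ with invertible differential. Moreover, if either $\phi_1=\pi_\alpha/2$ and $\tau_1\le\tau_2$, or $\phi_2\in\{\pi_\beta/2,\,3\pi_\beta/2\}$ and $\tau_2\le\tau_1$, then $\tau=t_{\mathrm{con}}$. -/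

import Mathlib

noncomputable section

/-- The integral `∫₀ˣ dt / √(1 - t^{2a})`; on `[0, 1]` it is strictly increasing. -/
def genArcsin (a : ℕ) (x : ℝ) : ℝ :=
  ∫ t in (0 : ℝ)..x, 1 / Real.sqrt (1 - t ^ (2 * a))

/-- The constant `π_a = 2 ∫₀¹ dt / √(1 - t^{2a})`. -/
def genPi (a : ℕ) : ℝ := 2 * genArcsin a 1

/-- The inverse of `genArcsin a : [0, 1] → [0, π_a / 2]`; meaningful on `[0, π_a / 2]`. -/
def genSinQuarter (a : ℕ) (y : ℝ) : ℝ :=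
  Function.invFunOn (genArcsin a) (Set.Icc 0 1) y

/-- Extension to `[0, π_a]` by reflection about `π_a / 2`. -/
def genSinHalf (a : ℕ) (y : ℝ) : ℝ :=
  if y ≤ genPi a / 2 then genSinQuarter a y else genSinQuarter a (genPi a - y)

/-- Odd extension to `[-π_a, π_a]`. -/
def genSinPeriod (a : ℕ) (y : ℝ) : ℝ :=
  if 0 ≤ y then genSinHalf a y else -genSinHalf a (-y)

/-- The generalized sine `sin_a = sin_{2a,2}`: the `2π_a`-periodic extension. The argument is
first translated into `[-π_a, π_a)` by a multiple of `2π_a`. -/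
def genSin (a : ℕ) (y : ℝ) : ℝ :=
  genSinPeriod a (y - 2 * genPi a * (⌊(y + genPi a) / (2 * genPi a)⌋ : ℝ))

/-- The generalized cosine, the derivative of the generalized sine. -/
def genCos (a : ℕ) (y : ℝ) : ℝ := deriv (genSin a) y

/-- `ρ_a(x) = |x|^{a-1} x`, used for `a ≥ 1`. -/
def genRho (a : ℕ) (x : ℝ) : ℝ := |x| ^ (a - 1) * x

/-- The frame `X₁ = ∂_x`, `X₂ = x^α ∂_y`, `X₃ = x^α y^β ∂_z` on `ℝ³`, at the point `q = (x, y, z)`. -/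
def grushinFrame (α β : ℕ) (q : ℝ × ℝ × ℝ) : Fin 3 → ℝ × ℝ × ℝ :=
  ![(1, 0, 0), (0, q.1 ^ α, 0), (0, 0, q.1 ^ α * q.2.1 ^ β)]

/-- The frame spans the tangent space at `q`. -/
def IsRiemannianPoint (α β : ℕ) (q : ℝ × ℝ × ℝ) : Prop :=
  Submodule.span ℝ (Set.range (grushinFrame α β q)) = ⊤

/-- The pairing of a covector `p` with a tangent vector `X`, in the coordinates of `ℝ³`. -/
def covectorPairing (p X : ℝ × ℝ × ℝ) : ℝ := p.1 * X.1 + p.2.1 * X.2.1 + p.2.2 * X.2.2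

/-- The sub-Riemannian Hamiltonian `H(q, p) = ½ ∑ⱼ ⟨p, Xⱼ(q)⟩²`. -/
def grushinHamiltonian (α β : ℕ) (q p : ℝ × ℝ × ℝ) : ℝ :=
  (1 / 2) * ∑ j : Fin 3, covectorPairing p (grushinFrame α β q j) ^ 2

/-- `(q(t), p(t))`, `t ∈ ℝ`, solves Hamilton's equations `q' = ∂H/∂p`, `p' = -∂H/∂q`. -/
structure IsGrushinExtremal (α β : ℕ) (q p : ℝ → ℝ × ℝ × ℝ) : Prop where
  x_eq : ∀ t, HasDerivAt (fun s => (q s).1)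
    (deriv (fun u => grushinHamiltonian α β (q t) (u, (p t).2.1, (p t).2.2)) (p t).1) t
  y_eq : ∀ t, HasDerivAt (fun s => (q s).2.1)
    (deriv (fun v => grushinHamiltonian α β (q t) ((p t).1, v, (p t).2.2)) (p t).2.1) t
  z_eq : ∀ t, HasDerivAt (fun s => (q s).2.2)
    (deriv (fun w => grushinHamiltonian α β (q t) ((p t).1, (p t).2.1, w)) (p t).2.2) t
  u_eq : ∀ t, HasDerivAt (fun s => (p s).1)
    (-deriv (fun x => grushinHamiltonian α β (x, (q t).2.1, (q t).2.2) (p t)) (q t).1) t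
  v_eq : ∀ t, HasDerivAt (fun s => (p s).2.1)
    (-deriv (fun y => grushinHamiltonian α β ((q t).1, y, (q t).2.2) (p t)) (q t).2.1) t
  w_eq : ∀ t, HasDerivAt (fun s => (p s).2.2)
    (-deriv (fun z => grushinHamiltonian α β ((q t).1, (q t).2.1, z) (p t)) (q t).2.2) t

/-- `γ` is a geodesic with initial point `q₀` and initial covector `p₀`: the projection of a
solution of Hamilton's equations starting at `(q₀, p₀)`. -/
def IsGrushinGeodesic (α β : ℕ) (q₀ p₀ : ℝ × ℝ × ℝ) (γ : ℝ → ℝ × ℝ × ℝ) : Prop :=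
  ∃ p : ℝ → ℝ × ℝ × ℝ, IsGrushinExtremal α β γ p ∧ γ 0 = q₀ ∧ p 0 = p₀

open Classical in
/-- The geodesic `γ(·; p₀)` with initial point `q₀` and initial covector `p₀`. -/
def grushinGeodesic (α β : ℕ) (q₀ p₀ : ℝ × ℝ × ℝ) : ℝ → ℝ × ℝ × ℝ :=
  if h : ∃ γ, IsGrushinGeodesic α β q₀ p₀ γ then h.choose else fun _ => q₀

/-- The exponential map `exp_{q₀}(p₀) = γ(1; p₀)`. -/
def grushinExp (α β : ℕ) (q₀ p₀ : ℝ × ℝ × ℝ) : ℝ × ℝ × ℝ := grushinGeodesic α β q₀ p₀ 1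

/-- `t > 0` is a conjugate time of `s ↦ exp_{q₀}(s p₀)`: the exponential map has a critical point
at `t p₀`, i.e. it is differentiable there and its differential is not onto. -/
def IsConjugateTime (α β : ℕ) (q₀ p₀ : ℝ × ℝ × ℝ) (t : ℝ) : Prop :=
  0 < t ∧ DifferentiableAt ℝ (grushinExp α β q₀) (t • p₀) ∧
    ¬ Function.Surjective (fderiv ℝ (grushinExp α β q₀) (t • p₀))

/-- The (first) conjugate time, the infimum of all conjugate times (`+∞` if there is none). -/
def conjugateTime (α β : ℕ) (q₀ p₀ : ℝ × ℝ × ℝ) : EReal :=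
  sInf ((fun t : ℝ => (t : EReal)) '' {t | IsConjugateTime α β q₀ p₀ t})

/-- The rectangle `[0, π_α] × [0, 2π_β)` of generalized spherical coordinates. -/
def sphericalDomain (α β : ℕ) : Set (ℝ × ℝ) :=
  Set.Icc 0 (genPi α) ×ˢ Set.Ico 0 (2 * genPi β)

/-- The covector with generalized spherical coordinates `φ = (φ₁, φ₂)`. -/
def sphericalCovector (α β : ℕ) (q₀ : ℝ × ℝ × ℝ) (φ : ℝ × ℝ) : ℝ × ℝ × ℝ :=
  (genCos α φ.1,
   genCos β φ.2 * genRho α (genSin α φ.1 / q₀.1),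
   genRho α (genSin α φ.1 / q₀.1) * genRho β (genSin β φ.2 / q₀.2.1))

/-- `ω₁ = sin_α(φ₁) / x₀`. -/
def omegaOne (α : ℕ) (q₀ : ℝ × ℝ × ℝ) (φ : ℝ × ℝ) : ℝ := genSin α φ.1 / q₀.1

/-- `ω₂ = (sin_β(φ₂) / y₀) ρ_α(sin_α(φ₁) / x₀)`. -/
def omegaTwo (α β : ℕ) (q₀ : ℝ × ℝ × ℝ) (φ : ℝ × ℝ) : ℝ :=
  genSin β φ.2 / q₀.2.1 * genRho α (genSin α φ.1 / q₀.1)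

open Classical in
/-- `τ₁`, for the covector `sphericalCovector α β q₀ φ`. -/
def tauOne (α β : ℕ) (q₀ : ℝ × ℝ × ℝ) (φ : ℝ × ℝ) : EReal :=
  if sphericalCovector α β q₀ φ = (1, 0, 0) ∨ sphericalCovector α β q₀ φ = (-1, 0, 0) then ⊤
  else ((genPi α / |omegaOne α q₀ φ| : ℝ) : EReal)

/-- The times `t > 0` with `|ω₂| ∫₀ᵗ x(s)^{2α} ds = π_β`, where `x` is the first coordinate of the
geodesic with initial covector `sphericalCovector α β q₀ φ`. -/
def tauTwoSet (α β : ℕ) (q₀ : ℝ × ℝ × ℝ) (φ : ℝ × ℝ) : Set ℝ :=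
  {t | 0 < t ∧ |omegaTwo α β q₀ φ| *
    (∫ s in (0 : ℝ)..t, (grushinGeodesic α β q₀ (sphericalCovector α β q₀ φ) s).1 ^ (2 * α))
      = genPi β}

open Classical in
/-- `τ₂`, for the covector `sphericalCovector α β q₀ φ`. -/
def tauTwo (α β : ℕ) (q₀ : ℝ × ℝ × ℝ) (φ : ℝ × ℝ) : EReal :=
  if (sphericalCovector α β q₀ φ).2.2 = 0 then ⊤
  else sInf ((fun t : ℝ => (t : EReal)) '' tauTwoSet α β q₀ φ)

end

noncomputable section

open Set Filter Topology

section GenArcsin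

variable {a : ℕ}

theorem one_sub_pow_pos (ha : 1 ≤ a) {t : ℝ} (ht : t ∈ Ioo (-1 : ℝ) 1) : 0 < 1 - t ^ (2 * a) := by
  have h : t ^ 2 < 1 := by nlinarith [ht.1, ht.2]
  have := pow_lt_one₀ (sq_nonneg t) h (by omega : a ≠ 0)
  rw [pow_mul]; linarith

theorem intervalIntegrable_genArcsin (ha : 1 ≤ a) :
    IntervalIntegrable (fun t : ℝ => 1 / Real.sqrt (1 - t ^ (2 * a))) MeasureTheory.volume (-1) 1 := by
  have h1 : IntervalIntegrable (fun t : ℝ => 1 / Real.sqrt (1 - t ^ 2)) MeasureTheory.volume (-1) 1 := by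
    refine intervalIntegral.intervalIntegrable_deriv_of_nonneg (g := Real.arcsin)
      Real.continuous_arcsin.continuousOn (fun x hx => ?_) (fun x _ => by positivity)
    rw [min_eq_left (by norm_num), max_eq_right (by norm_num)] at hx
    exact Real.hasDerivAt_arcsin hx.1.ne' hx.2.ne
  refine h1.mono_fun (by measurability) ?_
  rw [uIoc_of_le (by norm_num)]
  filter_upwards [MeasureTheory.ae_restrict_mem measurableSet_Ioc,
    MeasureTheory.ae_restrict_of_ae (MeasureTheory.Measure.ae_ne MeasureTheory.volume (1 : ℝ))]
    with t ht ht1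
  have hlt : t ∈ Ioo (-1 : ℝ) 1 := ⟨ht.1, lt_of_le_of_ne ht.2 ht1⟩
  have h2 : t ^ 2 ≤ 1 := by nlinarith [hlt.1, hlt.2]
  have h3 : t ^ (2 * a) ≤ t ^ 2 := by
    rw [pow_mul]
    exact pow_le_of_le_one (sq_nonneg t) h2 (by omega)
  have h4 : 0 < 1 - t ^ 2 := by simpa using one_sub_pow_pos le_rfl hlt
  rw [Real.norm_of_nonneg (by positivity), Real.norm_of_nonneg (by positivity)]
  exact one_div_le_one_div_of_le (Real.sqrt_pos.2 h4) (Real.sqrt_le_sqrt (by linarith))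

theorem continuousOn_genArcsin (ha : 1 ≤ a) : ContinuousOn (genArcsin a) (Icc (-1) 1) := by
  have := intervalIntegral.continuousOn_primitive_interval' (intervalIntegrable_genArcsin ha)
    (a := 0) (by rw [uIcc_of_le (by norm_num)]; constructor <;> norm_num)
  rwa [uIcc_of_le (by norm_num)] at this

theorem hasDerivAt_genArcsin (ha : 1 ≤ a) {x : ℝ} (hx : x ∈ Ioo (-1 : ℝ) 1) :
    HasDerivAt (genArcsin a) (1 / Real.sqrt (1 - x ^ (2 * a))) x := by
  refine intervalIntegral.integral_hasDerivAt_right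
    ((intervalIntegrable_genArcsin ha).mono_set ?_) ?_ ?_
  · rw [uIcc_of_le (by norm_num : (-1 : ℝ) ≤ 1)]
    exact uIcc_subset_Icc ⟨by norm_num, by norm_num⟩ (Ioo_subset_Icc_self hx)
  · exact Measurable.stronglyMeasurable (by fun_prop) |>.stronglyMeasurableAtFilter
  · refine ContinuousAt.div continuousAt_const (by fun_prop) ?_
    exact (Real.sqrt_pos.2 (one_sub_pow_pos ha hx)).ne'

theorem sub_le_genArcsin_sub (ha : 1 ≤ a) {x y : ℝ} (hx : x ∈ Icc (-1 : ℝ) 1)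
    (hy : y ∈ Icc (-1 : ℝ) 1) (hxy : x ≤ y) : y - x ≤ genArcsin a y - genArcsin a x := by
  have hm : MonotoneOn (fun x => genArcsin a x - x) (Icc (-1) 1) := by
    refine monotoneOn_of_deriv_nonneg (convex_Icc _ _)
      ((continuousOn_genArcsin ha).sub continuousOn_id) ?_ ?_
    · rw [interior_Icc]
      exact fun x hx => ((hasDerivAt_genArcsin ha hx).sub
        (hasDerivAt_id x)).differentiableAt.differentiableWithinAt
    · rw [interior_Icc]
      intro x hx
      rw [((hasDerivAt_genArcsin ha hx).fun_sub (hasDerivAt_id' x)).deriv, sub_nonneg]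
      rw [le_div_iff₀ (Real.sqrt_pos.2 (one_sub_pow_pos ha hx)), one_mul,
        Real.sqrt_le_left zero_le_one, one_pow]
      have : 0 ≤ x ^ (2 * a) := by rw [pow_mul]; positivity
      linarith
  have := hm hx hy hxy
  simp only at this
  linarith

theorem genArcsin_neg (x : ℝ) : genArcsin a (-x) = -genArcsin a x := by
  unfold genArcsin
  have := intervalIntegral.integral_comp_neg (a := 0) (b := x)
    (fun t : ℝ => 1 / Real.sqrt (1 - t ^ (2 * a)))
  rw [neg_zero] at this
  rw [intervalIntegral.integral_symm, ← this]
  simp [pow_mul]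

@[simp] theorem genArcsin_zero : genArcsin a 0 = 0 := by simp [genArcsin]

theorem genPi_pos (ha : 1 ≤ a) : 0 < genPi a := by
  have := sub_le_genArcsin_sub ha (x := 0) (y := 1) ⟨by norm_num, by norm_num⟩
    ⟨by norm_num, by norm_num⟩ (by norm_num)
  rw [genArcsin_zero] at this
  unfold genPi; linarith

theorem genArcsin_one : genArcsin a 1 = genPi a / 2 := by unfold genPi; ring

theorem genArcsin_injOn (ha : 1 ≤ a) : InjOn (genArcsin a) (Icc (-1) 1) := by
  intro x hx y hy h
  rcases le_total x y with hxy | hxy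
  · have := sub_le_genArcsin_sub ha hx hy hxy
    linarith
  · have := sub_le_genArcsin_sub ha hy hx hxy
    linarith

end GenArcsin

theorem hasDerivAt_of_eventually_ne {f g : ℝ → ℝ} {x : ℝ}
    (h : ∀ᶠ y in 𝓝[≠] x, HasDerivAt f (g y) y) (hf : ContinuousAt f x) (hg : ContinuousAt g x) :
    HasDerivAt f (g x) x := by
  obtain ⟨ε, hε, hb⟩ := Metric.eventually_nhds_iff.1 (eventually_nhdsWithin_iff.1 h)
  have hd : ∀ y, y ∈ Ioo (x - ε) (x + ε) → y ≠ x → HasDerivAt f (g y) y := fun y hy hne =>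
    hb (by rw [Real.dist_eq, abs_lt]; constructor <;> linarith [hy.1, hy.2]) hne
  have A : HasDerivWithinAt f (g x) (Ici x) x := by
    refine hasDerivWithinAt_Ici_of_tendsto_deriv (s := Ioo x (x + ε))
      (fun y hy => (hd y ⟨by linarith [hy.1], hy.2⟩ hy.1.ne').differentiableAt.differentiableWithinAt)
      hf.continuousWithinAt (Ioo_mem_nhdsGT (by linarith)) ?_
    refine (tendsto_inf_left hg).congr' ?_
    filter_upwards [Ioo_mem_nhdsGT (show x < x + ε by linarith)] with y hy
    exact (hd y ⟨by linarith [hy.1], hy.2⟩ hy.1.ne').deriv.symm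
  have B : HasDerivWithinAt f (g x) (Iic x) x := by
    refine hasDerivWithinAt_Iic_of_tendsto_deriv (s := Ioo (x - ε) x)
      (fun y hy => (hd y ⟨hy.1, by linarith [hy.2]⟩ hy.2.ne).differentiableAt.differentiableWithinAt)
      hf.continuousWithinAt (Ioo_mem_nhdsLT (by linarith)) ?_
    refine (tendsto_inf_left hg).congr' ?_
    filter_upwards [Ioo_mem_nhdsLT (show x - ε < x by linarith)] with y hy
    exact (hd y ⟨hy.1, by linarith [hy.2]⟩ hy.2.ne).deriv.symm
  simpa using B.union A

section GenSin

variable {a : ℕ}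

theorem exists_genArcsin_eq (ha : 1 ≤ a) {y : ℝ} (hy : y ∈ Icc 0 (genPi a / 2)) :
    ∃ x ∈ Icc (0 : ℝ) 1, genArcsin a x = y := by
  have := intermediate_value_Icc (zero_le_one (α := ℝ))
    ((continuousOn_genArcsin ha).mono (Icc_subset_Icc_left (by norm_num)))
  rw [genArcsin_zero, genArcsin_one] at this
  exact this hy

theorem genSinQuarter_mem (ha : 1 ≤ a) {y : ℝ} (hy : y ∈ Icc 0 (genPi a / 2)) :
    genSinQuarter a y ∈ Icc (0 : ℝ) 1 :=
  Function.invFunOn_mem (exists_genArcsin_eq ha hy)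

theorem genArcsin_genSinQuarter (ha : 1 ≤ a) {y : ℝ} (hy : y ∈ Icc 0 (genPi a / 2)) :
    genArcsin a (genSinQuarter a y) = y :=
  Function.invFunOn_eq (exists_genArcsin_eq ha hy)

theorem genSinQuarter_zero (ha : 1 ≤ a) : genSinQuarter a 0 = 0 := by
  have hp := genPi_pos ha
  have h0 : (0 : ℝ) ∈ Icc 0 (genPi a / 2) := ⟨le_rfl, by linarith⟩
  refine genArcsin_injOn ha (Icc_subset_Icc_left (by norm_num) (genSinQuarter_mem ha h0))
    ⟨by norm_num, by norm_num⟩ ?_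
  rw [genArcsin_genSinQuarter ha h0, genArcsin_zero]

theorem genSinHalf_reflect (y : ℝ) : genSinHalf a (genPi a - y) = genSinHalf a y := by
  unfold genSinHalf
  rcases lt_trichotomy y (genPi a / 2) with h | h | h
  · rw [if_neg (by linarith), if_pos h.le, sub_sub_cancel]
  · rw [if_pos (by linarith), if_pos h.le]; congr 1; linarith
  · rw [if_pos (by linarith), if_neg (by linarith)]

theorem genSin_periodic (ha : 1 ≤ a) : Function.Periodic (genSin a) (2 * genPi a) := by
  intro y
  have hp := genPi_pos ha
  unfold genSin
  have : (y + 2 * genPi a + genPi a) / (2 * genPi a) = (y + genPi a) / (2 * genPi a) + 1 := by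
    field_simp; ring
  rw [this, Int.floor_add_one]
  congr 1
  push_cast
  ring

theorem genSin_of_mem (ha : 1 ≤ a) {y : ℝ} (hy : y ∈ Ico (-genPi a) (genPi a)) :
    genSin a y = genSinPeriod a y := by
  have hp := genPi_pos ha
  have : ⌊(y + genPi a) / (2 * genPi a)⌋ = 0 := by
    rw [Int.floor_eq_zero_iff]
    constructor
    · exact div_nonneg (by linarith [hy.1]) (by linarith)
    · rw [div_lt_one (by linarith)]; linarith [hy.2]
  simp [genSin, this]

theorem genSin_antiperiodic (ha : 1 ≤ a) : Function.Antiperiodic (genSin a) (genPi a) := by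
  have hp := genPi_pos ha
  have key : ∀ y ∈ Ioc (-genPi a) 0, genSin a (y + genPi a) = -genSin a y := by
    intro y hy
    rcases eq_or_lt_of_le hy.2 with h0 | h0
    · subst h0
      have h1 : genSin a (0 + genPi a) = genSin a (-genPi a) := by
        rw [← genSin_periodic ha (-genPi a)]; congr 1; ring
      rw [h1, genSin_of_mem ha ⟨le_rfl, by linarith⟩, genSin_of_mem ha ⟨by linarith, hp⟩]
      unfold genSinPeriod
      rw [if_neg (by linarith), if_pos le_rfl, neg_neg]
      have h2 := genSinHalf_reflect (a := a) 0
      rw [sub_zero] at h2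
      rw [h2]
    · rw [genSin_of_mem ha ⟨by linarith [hy.1], by linarith⟩,
        genSin_of_mem ha ⟨hy.1.le, by linarith⟩]
      unfold genSinPeriod
      rw [if_pos (by linarith [hy.1]), if_neg (by linarith), neg_neg]
      rw [← genSinHalf_reflect (-y)]
      congr 1; ring
  have hper : Function.Periodic (fun y => genSin a (y + genPi a) = -genSin a y) (2 * genPi a) := by
    intro y
    simp only [genSin_periodic ha y]
    rw [add_right_comm, genSin_periodic ha]
  intro y
  obtain ⟨z, hz, hyz⟩ := hper.exists_mem_Ioc (by linarith) y (-genPi a)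
  rw [hyz]
  rcases le_or_gt z 0 with h | h
  · exact key z ⟨hz.1, h⟩
  · rcases eq_or_lt_of_le (show z ≤ genPi a by linarith [hz.2]) with h1 | h1
    · have h0 := key 0 ⟨by linarith, le_rfl⟩
      rw [zero_add] at h0
      rw [h1, ← two_mul, h0]
      have := genSin_periodic ha 0
      rw [zero_add] at this
      rw [this, neg_neg]
    · have := key (z - genPi a) ⟨by linarith, by linarith⟩
      rw [sub_add_cancel] at this
      rw [this, neg_neg, ← genSin_periodic ha (z - genPi a)]
      congr 1; ring

theorem genSin_of_mem_half (ha : 1 ≤ a) {y : ℝ} (hy : y ∈ Icc 0 (genPi a / 2)) :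
    genSin a y = genSinQuarter a y := by
  have hp := genPi_pos ha
  rw [genSin_of_mem ha ⟨by linarith [hy.1], by linarith [hy.2]⟩, genSinPeriod, if_pos hy.1,
    genSinHalf, if_pos hy.2]

theorem genSin_of_mem_neg_half (ha : 1 ≤ a) {y : ℝ} (hy : y ∈ Ico (-(genPi a / 2)) 0) :
    genSin a y = -genSinQuarter a (-y) := by
  have hp := genPi_pos ha
  rw [genSin_of_mem ha ⟨by linarith [hy.1], by linarith [hy.2]⟩, genSinPeriod,
    if_neg (by linarith [hy.2]), genSinHalf, if_pos (by linarith [hy.1])]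

@[simp] theorem genSin_zero (ha : 1 ≤ a) : genSin a 0 = 0 := by
  have hp := genPi_pos ha
  rw [genSin_of_mem_half ha ⟨le_rfl, by linarith⟩, genSinQuarter_zero ha]

theorem genSin_mem (ha : 1 ≤ a) {y : ℝ} (hy : y ∈ Icc (-(genPi a / 2)) (genPi a / 2)) :
    genSin a y ∈ Icc (-1 : ℝ) 1 := by
  rcases le_or_gt 0 y with h | h
  · rw [genSin_of_mem_half ha ⟨h, hy.2⟩]
    exact Icc_subset_Icc_left (by norm_num) (genSinQuarter_mem ha ⟨h, hy.2⟩)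
  · rw [genSin_of_mem_neg_half ha ⟨hy.1, h⟩]
    have := genSinQuarter_mem ha (y := -y) ⟨by linarith, by linarith [hy.1]⟩
    exact ⟨by linarith [this.2], by linarith [this.1]⟩

theorem genArcsin_genSin (ha : 1 ≤ a) {y : ℝ} (hy : y ∈ Icc (-(genPi a / 2)) (genPi a / 2)) :
    genArcsin a (genSin a y) = y := by
  rcases le_or_gt 0 y with h | h
  · rw [genSin_of_mem_half ha ⟨h, hy.2⟩, genArcsin_genSinQuarter ha ⟨h, hy.2⟩]
  · rw [genSin_of_mem_neg_half ha ⟨hy.1, h⟩, genArcsin_neg,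
      genArcsin_genSinQuarter ha ⟨by linarith, by linarith [hy.1]⟩, neg_neg]

theorem genSin_half_pi (ha : 1 ≤ a) : genSin a (genPi a / 2) = 1 := by
  have hp := genPi_pos ha
  have hm : genPi a / 2 ∈ Icc (-(genPi a / 2)) (genPi a / 2) := ⟨by linarith, le_rfl⟩
  refine genArcsin_injOn ha (genSin_mem ha hm) ⟨by norm_num, le_rfl⟩ ?_
  rw [genArcsin_genSin ha hm, genArcsin_one]

theorem lipschitzOnWith_genSin (ha : 1 ≤ a) :
    LipschitzOnWith 1 (genSin a) (Icc (-(genPi a / 2)) (genPi a / 2)) := by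
  refine LipschitzOnWith.of_dist_le_mul fun x hx y hy => ?_
  rw [Real.dist_eq, Real.dist_eq, NNReal.coe_one, one_mul]
  have hX := genArcsin_genSin ha hx
  have hY := genArcsin_genSin ha hy
  rcases le_total (genSin a x) (genSin a y) with h | h
  · have := sub_le_genArcsin_sub ha (genSin_mem ha hx) (genSin_mem ha hy) h
    rw [hX, hY] at this
    rw [abs_sub_comm, abs_of_nonneg (by linarith), abs_sub_comm]
    exact this.trans (le_abs_self _)
  · have := sub_le_genArcsin_sub ha (genSin_mem ha hy) (genSin_mem ha hx) h
    rw [hX, hY] at this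
    rw [abs_of_nonneg (by linarith)]
    exact this.trans (le_abs_self _)

theorem genSin_mem_Ioo (ha : 1 ≤ a) {y : ℝ} (hy : y ∈ Ioo (-(genPi a / 2)) (genPi a / 2)) :
    genSin a y ∈ Ioo (-1 : ℝ) 1 := by
  have h := genSin_mem ha (Ioo_subset_Icc_self hy)
  have h2 := genArcsin_genSin ha (Ioo_subset_Icc_self hy)
  refine ⟨lt_of_le_of_ne h.1 fun h3 => ?_, lt_of_le_of_ne h.2 fun h3 => ?_⟩
  · rw [← h3, genArcsin_neg, genArcsin_one] at h2
    linarith [hy.1]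
  · rw [h3, genArcsin_one] at h2
    linarith [hy.2]

theorem genSin_reflect (ha : 1 ≤ a) {y : ℝ} (hy : y ∈ Icc 0 (genPi a)) :
    genSin a (genPi a - y) = genSin a y := by
  have hp := genPi_pos ha
  have hgen : ∀ y ∈ Ico 0 (genPi a), genSin a y = genSinHalf a y := fun y hy => by
    rw [genSin_of_mem ha ⟨by linarith [hy.1], hy.2⟩, genSinPeriod, if_pos hy.1]
  have hpi : genSin a (genPi a) = 0 := by
    rw [← zero_add (genPi a), genSin_antiperiodic ha, genSin_zero ha, neg_zero]
  rcases eq_or_lt_of_le hy.1 with h | h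
  · subst h; rw [sub_zero, hpi, genSin_zero ha]
  rcases eq_or_lt_of_le hy.2 with h' | h'
  · subst h'; rw [sub_self, hpi, genSin_zero ha]
  · rw [hgen _ ⟨by linarith, by linarith⟩, hgen _ ⟨h.le, h'⟩, genSinHalf_reflect]

theorem hasDerivAt_genSin_of_mem_Ioo (ha : 1 ≤ a) {y : ℝ}
    (hy : y ∈ Ioo (-(genPi a / 2)) (genPi a / 2)) :
    HasDerivAt (genSin a) (Real.sqrt (1 - genSin a y ^ (2 * a))) y := by
  have hm := genSin_mem_Ioo ha hy
  have hs := Real.sqrt_pos.2 (one_sub_pow_pos ha hm)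
  have := HasDerivAt.of_local_left_inverse (f := genArcsin a) (g := genSin a)
    ((lipschitzOnWith_genSin ha).continuousOn.continuousAt (Icc_mem_nhds hy.1 hy.2))
    (hasDerivAt_genArcsin ha hm) (by positivity)
    (by filter_upwards [Ioo_mem_nhds hy.1 hy.2] with z hz using
      genArcsin_genSin ha (Ioo_subset_Icc_self hz))
  simpa using this

theorem hasDerivAt_genSin_half_pi (ha : 1 ≤ a) : HasDerivAt (genSin a) 0 (genPi a / 2) := by
  have hp := genPi_pos ha
  have hc : ContinuousAt (genSin a) (genPi a / 2) := by
    rw [continuousAt_iff_continuous_left_right]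
    have hleft : ContinuousWithinAt (genSin a) (Iic (genPi a / 2)) (genPi a / 2) := by
      refine ((lipschitzOnWith_genSin ha).continuousOn _ ⟨by linarith, le_rfl⟩).mono_of_mem_nhdsWithin ?_
      exact Icc_mem_nhdsLE (by linarith)
    refine ⟨hleft, ?_⟩
    have h1 : ContinuousWithinAt (fun y => genSin a (genPi a - y)) (Ici (genPi a / 2)) (genPi a / 2) := by
      refine ContinuousWithinAt.comp (g := genSin a) (f := fun y => genPi a - y)
        (t := Iic (genPi a / 2)) ?_ (by fun_prop) ?_
      · convert hleft using 1; ring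
      · intro y hy
        simp only [mem_Ici, mem_Iic] at *
        linarith
    refine h1.congr_of_eventuallyEq ?_ ?_
    · filter_upwards [Icc_mem_nhdsGE (show genPi a / 2 < genPi a by linarith)] with y hy
      exact (genSin_reflect ha ⟨by linarith [hy.1], hy.2⟩).symm
    · exact (genSin_reflect ha ⟨by linarith, by linarith⟩).symm
  have hR : ∀ y ∈ Ioo (genPi a / 2) (genPi a), HasDerivAt (genSin a)
      (-Real.sqrt (1 - genSin a y ^ (2 * a))) y := by
    intro y hy
    have h1 := hasDerivAt_genSin_of_mem_Ioo ha (y := genPi a - y) ⟨by linarith [hy.2], by linarith [hy.1]⟩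
    have h2 := HasDerivAt.comp_const_sub (genPi a) y h1
    rw [genSin_reflect ha ⟨by linarith [hy.1], hy.2.le⟩] at h2
    refine h2.congr_of_eventuallyEq ?_
    filter_upwards [Ioo_mem_nhds hy.1 hy.2] with z hz
    exact (genSin_reflect ha ⟨by linarith [hz.1], hz.2.le⟩).symm
  let g : ℝ → ℝ := fun y => if y ≤ genPi a / 2 then Real.sqrt (1 - genSin a y ^ (2 * a))
    else -Real.sqrt (1 - genSin a y ^ (2 * a))
  have hg0 : g (genPi a / 2) = 0 := by simp [g, genSin_half_pi ha]
  have hgc : ContinuousAt g (genPi a / 2) := by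
    rw [ContinuousAt, hg0]
    rw [tendsto_zero_iff_abs_tendsto_zero]
    have h1 : (abs ∘ g) = fun y => Real.sqrt (1 - genSin a y ^ (2 * a)) := by
      ext y
      simp only [g, Function.comp]
      split_ifs <;> simp [abs_of_nonneg, Real.sqrt_nonneg]
    rw [h1]
    have h2 : ContinuousAt (fun y => Real.sqrt (1 - genSin a y ^ (2 * a))) (genPi a / 2) := by
      fun_prop
    have h3 := h2.tendsto
    simpa [genSin_half_pi ha] using h3
  rw [← hg0]
  refine hasDerivAt_of_eventually_ne ?_ hc hgc
  filter_upwards [self_mem_nhdsWithin,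
    mem_nhdsWithin_of_mem_nhds (Ioo_mem_nhds (show 0 < genPi a / 2 by linarith)
      (show genPi a / 2 < genPi a by linarith))] with y hne hy
  rcases lt_or_gt_of_ne hne with h | h
  · simp only [g, if_pos h.le]
    exact hasDerivAt_genSin_of_mem_Ioo ha ⟨by linarith [hy.1], h⟩
  · simp only [g, if_neg (not_le.2 h)]
    exact hR y ⟨h, hy.2⟩

theorem genCos_of_mem_Ioo (ha : 1 ≤ a) {y : ℝ} (hy : y ∈ Ioo (-(genPi a / 2)) (genPi a / 2)) :
    genCos a y = Real.sqrt (1 - genSin a y ^ (2 * a)) :=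
  (hasDerivAt_genSin_of_mem_Ioo ha hy).deriv

theorem genCos_half_pi (ha : 1 ≤ a) : genCos a (genPi a / 2) = 0 :=
  (hasDerivAt_genSin_half_pi ha).deriv

theorem Function.Antiperiodic.hasDerivAt_add_iff {f : ℝ → ℝ} {p c y : ℝ}
    (hf : Function.Antiperiodic f p) : HasDerivAt f (-c) (y + p) ↔ HasDerivAt f c y := by
  constructor
  · intro h
    simpa [hf _] using (h.comp_add_const y p).fun_neg
  · intro h
    have h1 : HasDerivAt f c (y + p - p) := by rwa [add_sub_cancel_right]
    simpa [hf.sub_eq] using (h1.comp_sub_const (y + p) p).fun_neg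

theorem Function.Antiperiodic.continuousAt_add_iff {f : ℝ → ℝ} {p y : ℝ}
    (hf : Function.Antiperiodic f p) : ContinuousAt f (y + p) ↔ ContinuousAt f y := by
  constructor
  · intro h
    have h1 : ContinuousAt (fun z => -f (z + p)) y :=
      (ContinuousAt.comp (g := f) (f := fun z => z + p) h (by fun_prop)).neg
    simpa [hf _] using h1
  · intro h
    have h1 : ContinuousAt (fun z => -f (z - p)) (y + p) :=
      (ContinuousAt.comp (g := f) (f := fun z => z - p) (by rwa [add_sub_cancel_right])
        (by fun_prop)).neg
    simpa [hf.sub_eq] using h1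

theorem genCos_antiperiodic (ha : 1 ≤ a) : Function.Antiperiodic (genCos a) (genPi a) := by
  intro y
  have hfun : (fun z => genSin a (z + genPi a)) = fun z => -genSin a z :=
    funext (genSin_antiperiodic ha)
  unfold genCos
  rw [← deriv_comp_add_const, hfun, deriv.fun_neg]

/-- To prove a `π_a`-periodic property it suffices to treat `(-π_a / 2, π_a / 2]`. -/
theorem forall_of_genPi_periodic (ha : 1 ≤ a) {Q : ℝ → Prop} (hQ : ∀ y, Q (y + genPi a) ↔ Q y)
    (h : ∀ y ∈ Ioc (-(genPi a / 2)) (genPi a / 2), Q y) (y : ℝ) : Q y := by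
  have hper : Function.Periodic Q (genPi a) := fun y => propext (hQ y)
  obtain ⟨z, hz, hyz⟩ := hper.exists_mem_Ioc (genPi_pos ha) y (-(genPi a / 2))
  rw [hyz]
  exact h z ⟨hz.1, by linarith [hz.2]⟩

theorem hasDerivAt_genSin (ha : 1 ≤ a) (y : ℝ) : HasDerivAt (genSin a) (genCos a y) y := by
  refine forall_of_genPi_periodic (Q := fun y => HasDerivAt (genSin a) (genCos a y) y) ha
    (fun y => ?_) (fun y hy => ?_) y
  · rw [genCos_antiperiodic ha, (genSin_antiperiodic ha).hasDerivAt_add_iff]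
  · rcases eq_or_lt_of_le hy.2 with h | h
    · rw [h, genCos_half_pi ha]; exact hasDerivAt_genSin_half_pi ha
    · exact (hasDerivAt_genSin_of_mem_Ioo ha ⟨hy.1, h⟩).differentiableAt.hasDerivAt

theorem continuous_genSin (ha : 1 ≤ a) : Continuous (genSin a) :=
  continuous_iff_continuousAt.2 fun y => (hasDerivAt_genSin ha y).continuousAt

theorem genCos_sq_add (ha : 1 ≤ a) (y : ℝ) : genCos a y ^ 2 + genSin a y ^ (2 * a) = 1 := by
  refine forall_of_genPi_periodic (Q := fun y => genCos a y ^ 2 + genSin a y ^ (2 * a) = 1) ha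
    (fun y => ?_) (fun y hy => ?_) y
  · rw [genCos_antiperiodic ha, genSin_antiperiodic ha, neg_sq, pow_mul, neg_sq, ← pow_mul]
  · rcases eq_or_lt_of_le hy.2 with h | h
    · rw [h, genCos_half_pi ha, genSin_half_pi ha]; simp
    · rw [genCos_of_mem_Ioo ha ⟨hy.1, h⟩, Real.sq_sqrt]
      · ring
      · exact (one_sub_pow_pos ha (genSin_mem_Ioo ha ⟨hy.1, h⟩)).le

theorem continuous_genCos (ha : 1 ≤ a) : Continuous (genCos a) := by
  refine continuous_iff_continuousAt.2 fun y => ?_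
  refine forall_of_genPi_periodic (Q := ContinuousAt (genCos a)) ha (fun y => ?_) (fun y hy => ?_) y
  · exact (genCos_antiperiodic ha).continuousAt_add_iff
  · rcases eq_or_lt_of_le hy.2 with h | h
    · have h1 : ContinuousAt (fun z => Real.sqrt (1 - genSin a z ^ (2 * a))) y := by
        have := (continuous_genSin ha).continuousAt (x := y)
        fun_prop
      have h2 : (fun z => Real.sqrt (1 - genSin a z ^ (2 * a))) = fun z => |genCos a z| := by
        ext z
        rw [← genCos_sq_add ha z, add_sub_cancel_right, Real.sqrt_sq_eq_abs]
      rw [h2] at h1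
      rw [ContinuousAt, h, genCos_half_pi ha, tendsto_zero_iff_abs_tendsto_zero]
      have h3 := h1.tendsto
      rw [h, genCos_half_pi ha, abs_zero] at h3
      exact h3
    · have h1 : ContinuousAt (fun z => Real.sqrt (1 - genSin a z ^ (2 * a))) y := by
        have := (continuous_genSin ha).continuousAt (x := y)
        fun_prop
      refine h1.congr ?_
      filter_upwards [Ioo_mem_nhds hy.1 h] with z hz
      exact (genCos_of_mem_Ioo ha hz).symm

theorem hasDerivAt_genCos (ha : 1 ≤ a) (y : ℝ) :
    HasDerivAt (genCos a) (-(a * genSin a y ^ (2 * a - 1))) y := by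
  have hodd : Odd (2 * a - 1) := ⟨a - 1, by omega⟩
  have hint : ∀ y ∈ Ioo (-(genPi a / 2)) (genPi a / 2),
      HasDerivAt (genCos a) (-(a * genSin a y ^ (2 * a - 1))) y := by
    intro y hy
    have hpos := one_sub_pow_pos ha (genSin_mem_Ioo ha hy)
    have h1 := (((hasDerivAt_genSin ha y).fun_pow (2 * a)).const_sub 1).sqrt hpos.ne'
    rw [← genCos_of_mem_Ioo ha hy] at h1
    have hne : genCos a y ≠ 0 := by rw [genCos_of_mem_Ioo ha hy]; exact (Real.sqrt_pos.2 hpos).ne'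
    refine (h1.congr_of_eventuallyEq ?_).congr_deriv ?_
    · filter_upwards [Ioo_mem_nhds hy.1 hy.2] with z hz
      exact genCos_of_mem_Ioo ha hz
    · push_cast
      field_simp
  refine forall_of_genPi_periodic
    (Q := fun y => HasDerivAt (genCos a) (-(a * genSin a y ^ (2 * a - 1))) y) ha
    (fun y => ?_) (fun y hy => ?_) y
  · rw [genSin_antiperiodic ha, hodd.neg_pow, mul_neg, (genCos_antiperiodic ha).hasDerivAt_add_iff]
  · rcases eq_or_lt_of_le hy.2 with h | h
    · have hp := genPi_pos ha
      refine hasDerivAt_of_eventually_ne (g := fun y => -(a * genSin a y ^ (2 * a - 1))) ?_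
        (continuous_genCos ha).continuousAt ?_
      · filter_upwards [self_mem_nhdsWithin,
          mem_nhdsWithin_of_mem_nhds (Ioo_mem_nhds (show 0 < y by linarith)
            (show y < 3 * genPi a / 2 by linarith))] with z hne hz
        rcases lt_or_gt_of_ne hne with h1 | h1
        · exact hint z ⟨by linarith [hz.1], by linarith⟩
        · have h2 := hint (z - genPi a) ⟨by linarith, by linarith [hz.2]⟩
          rw [← (genCos_antiperiodic ha).hasDerivAt_add_iff, sub_add_cancel,
            (genSin_antiperiodic ha).sub_eq, hodd.neg_pow, mul_neg] at h2
          simpa using h2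
      · have := (continuous_genSin ha).continuousAt (x := y)
        fun_prop
    · exact hint y ⟨hy.1, h⟩

theorem genCos_pos (ha : 1 ≤ a) {y : ℝ} (hy : y ∈ Ioo (-(genPi a / 2)) (genPi a / 2)) :
    0 < genCos a y := by
  rw [genCos_of_mem_Ioo ha hy]
  exact Real.sqrt_pos.2 (one_sub_pow_pos ha (genSin_mem_Ioo ha hy))

theorem genCos_zero (ha : 1 ≤ a) : genCos a 0 = 1 := by
  have hp := genPi_pos ha
  rw [genCos_of_mem_Ioo ha ⟨by linarith, by linarith⟩, genSin_zero ha]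
  simp [show a ≠ 0 by omega]

theorem genSin_pi (ha : 1 ≤ a) : genSin a (genPi a) = 0 := by
  rw [← zero_add (genPi a), genSin_antiperiodic ha, genSin_zero ha, neg_zero]

theorem genCos_pi (ha : 1 ≤ a) : genCos a (genPi a) = -1 := by
  rw [← zero_add (genPi a), genCos_antiperiodic ha, genCos_zero ha]

theorem genSin_pos (ha : 1 ≤ a) {y : ℝ} (hy : y ∈ Ioo 0 (genPi a)) : 0 < genSin a y := by
  have key : ∀ y ∈ Ioc 0 (genPi a / 2), 0 < genSin a y := by
    intro y hy
    have hm : y ∈ Icc 0 (genPi a / 2) := ⟨hy.1.le, hy.2⟩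
    rw [genSin_of_mem_half ha hm]
    refine lt_of_le_of_ne (genSinQuarter_mem ha hm).1 fun h => ?_
    have := genArcsin_genSinQuarter ha hm
    rw [← h, genArcsin_zero] at this
    exact hy.1.ne this
  rcases le_or_gt y (genPi a / 2) with h | h
  · exact key y ⟨hy.1, h⟩
  · rw [← genSin_reflect ha ⟨hy.1.le, hy.2.le⟩]
    exact key _ ⟨by linarith [hy.2], by linarith⟩

end GenSin

section GenCurve

variable {a : ℕ}

theorem exists_genCos_genSin_of_nonneg (ha : 1 ≤ a) {X Y : ℝ} (hY : 0 ≤ Y)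
    (h : X ^ 2 + Y ^ (2 * a) = 1) : ∃ φ ∈ Icc 0 (genPi a), genCos a φ = X ∧ genSin a φ = Y := by
  have hp := genPi_pos ha
  have hY2 : 0 ≤ Y ^ (2 * a) := by positivity
  have hiv := intermediate_value_Icc' hp.le (continuous_genCos ha).continuousOn
  rw [genCos_zero ha, genCos_pi ha] at hiv
  obtain ⟨φ, hφ, hX⟩ := hiv (show X ∈ Icc (-1 : ℝ) 1 by constructor <;> nlinarith)
  refine ⟨φ, hφ, hX, ?_⟩
  have hs : 0 ≤ genSin a φ := by
    rcases eq_or_lt_of_le hφ.1 with h0 | h0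
    · rw [← h0, genSin_zero ha]
    rcases eq_or_lt_of_le hφ.2 with h1 | h1
    · rw [h1, genSin_pi ha]
    · exact (genSin_pos ha ⟨h0, h1⟩).le
  have h2 := genCos_sq_add ha φ
  rw [hX] at h2
  exact (pow_left_inj₀ hs hY (show 2 * a ≠ 0 by omega)).1 (by linarith)

theorem exists_genCos_genSin (ha : 1 ≤ a) {X Y : ℝ} (h : X ^ 2 + Y ^ (2 * a) = 1) :
    ∃ φ ∈ Ico 0 (2 * genPi a), genCos a φ = X ∧ genSin a φ = Y := by
  have hp := genPi_pos ha
  rcases le_or_gt 0 Y with hY | hY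
  · obtain ⟨φ, hφ, h1, h2⟩ := exists_genCos_genSin_of_nonneg ha hY h
    exact ⟨φ, ⟨hφ.1, by linarith [hφ.2]⟩, h1, h2⟩
  · obtain ⟨φ, hφ, h1, h2⟩ := exists_genCos_genSin_of_nonneg ha (X := -X) (Y := -Y) (by linarith)
      (by rw [neg_sq, pow_mul, neg_sq, ← pow_mul]; exact h)
    refine ⟨φ + genPi a, ⟨by linarith [hφ.1], ?_⟩, ?_, ?_⟩
    · have : φ ≠ genPi a := by
        rintro rfl
        rw [genSin_pi ha] at h2
        linarith
      have := lt_of_le_of_ne hφ.2 this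
      linarith
    · rw [genCos_antiperiodic ha, h1, neg_neg]
    · rw [genSin_antiperiodic ha, h2, neg_neg]

theorem strictMonoOn_genTan_sub (ha : 1 ≤ a) :
    StrictMonoOn (fun y => genSin a y / genCos a y - y) (Ioo (-(genPi a / 2)) (genPi a / 2)) := by
  have hp := genPi_pos ha
  have hd : ∀ y ∈ Ioo (-(genPi a / 2)) (genPi a / 2),
      HasDerivAt (fun y => genSin a y / genCos a y - y)
        (a * genSin a y ^ (2 * a) / genCos a y ^ 2) y := by
    intro y hy
    have hc := (genCos_pos ha hy).ne'
    refine (((hasDerivAt_genSin ha y).fun_div (hasDerivAt_genCos ha y) hc).fun_sub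
      (hasDerivAt_id' y)).congr_deriv ?_
    obtain ⟨n, hn⟩ : ∃ n, 2 * a = n + 1 := ⟨2 * a - 1, by omega⟩
    rw [hn, Nat.add_sub_cancel]
    field_simp
    ring
  have hpos : ∀ y ∈ Ioo (-(genPi a / 2)) (genPi a / 2), y ≠ 0 →
      0 < deriv (fun y => genSin a y / genCos a y - y) y := by
    intro y hy h0
    rw [(hd y hy).deriv]
    have hc := genCos_pos ha hy
    have hs : genSin a y ≠ 0 := by
      intro h
      have := genArcsin_genSin ha (Ioo_subset_Icc_self hy)
      rw [h, genArcsin_zero] at this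
      exact h0 this.symm
    have : 0 < genSin a y ^ (2 * a) := by rw [pow_mul]; positivity
    have : (0 : ℝ) < a := by exact_mod_cast ha
    positivity
  have h1 : StrictMonoOn (fun y => genSin a y / genCos a y - y) (Ioc (-(genPi a / 2)) 0) := by
    refine strictMonoOn_of_deriv_pos (convex_Ioc _ _) (fun y hy => ?_) (fun y hy => ?_)
    · exact (hd y ⟨hy.1, by linarith [hy.2]⟩).continuousAt.continuousWithinAt
    · rw [interior_Ioc] at hy
      exact hpos y ⟨hy.1, by linarith [hy.2]⟩ hy.2.ne
  have h2 : StrictMonoOn (fun y => genSin a y / genCos a y - y) (Ico 0 (genPi a / 2)) := by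
    refine strictMonoOn_of_deriv_pos (convex_Ico _ _) (fun y hy => ?_) (fun y hy => ?_)
    · exact (hd y ⟨by linarith [hy.1], hy.2⟩).continuousAt.continuousWithinAt
    · rw [interior_Ico] at hy
      exact hpos y ⟨by linarith [hy.1], hy.2⟩ hy.1.ne'
  have := h1.union h2 (c := 0) ⟨⟨by linarith, le_rfl⟩, fun y hy => hy.2⟩
    ⟨⟨le_rfl, by linarith⟩, fun y hy => hy.1⟩
  rwa [Ioc_union_Ico_eq_Ioo (by linarith) (by linarith)] at this

/-- Up to a positive factor, the Jacobian of the exponential map of a Grushin plane, in terms of the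
initial and the final phase of the geodesic. -/
def phaseJacobian (a : ℕ) (φ ψ : ℝ) : ℝ :=
  genCos a φ * genSin a ψ - genSin a φ * genCos a ψ - (ψ - φ) * genCos a φ * genCos a ψ

theorem phaseJacobian_pos (ha : 1 ≤ a) {φ ψ : ℝ} (h : φ < ψ) (h' : ψ < φ + genPi a) :
    0 < phaseJacobian a φ ψ := by
  have hp := genPi_pos ha
  have hm := strictMonoOn_genTan_sub ha
  revert ψ
  refine forall_of_genPi_periodic
    (Q := fun φ => ∀ {ψ : ℝ}, φ < ψ → ψ < φ + genPi a → 0 < phaseJacobian a φ ψ) ha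
    (fun φ => ?_) (fun φ hφ ψ h h' => ?_) φ
  · have hshift : ∀ ψ, phaseJacobian a (φ + genPi a) (ψ + genPi a) = phaseJacobian a φ ψ := by
      intro ψ
      simp only [phaseJacobian, genCos_antiperiodic ha _, genSin_antiperiodic ha _]
      ring
    constructor
    · intro H ψ h h'
      rw [← hshift]
      exact H (by linarith) (by linarith)
    · intro H ψ h h'
      have := hshift (ψ - genPi a)
      rw [sub_add_cancel] at this
      rw [this]
      exact H (by linarith) (by linarith)
  · rcases eq_or_lt_of_le hφ.2 with h0 | h0
    · have := genCos_pos ha (y := ψ - genPi a) ⟨by linarith, by linarith⟩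
      rw [(genCos_antiperiodic ha).sub_eq] at this
      rw [phaseJacobian, h0, genCos_half_pi ha, genSin_half_pi ha]
      linarith
    have hc := genCos_pos ha ⟨hφ.1, h0⟩
    rcases lt_trichotomy ψ (genPi a / 2) with h1 | h1 | h1
    · have hc' := genCos_pos ha (y := ψ) ⟨by linarith [hφ.1], h1⟩
      have := hm ⟨hφ.1, h0⟩ (show ψ ∈ Ioo _ _ from ⟨by linarith [hφ.1], h1⟩) h
      simp only at this
      have h2 : phaseJacobian a φ ψ = genCos a φ * genCos a ψ *
          ((genSin a ψ / genCos a ψ - ψ) - (genSin a φ / genCos a φ - φ)) := by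
        unfold phaseJacobian; field_simp; ring
      rw [h2]
      exact mul_pos (mul_pos hc hc') (by linarith)
    · rw [phaseJacobian, h1, genCos_half_pi ha, genSin_half_pi ha]
      linarith
    · obtain ⟨χ, rfl⟩ : ∃ χ, ψ = χ + genPi a := ⟨ψ - genPi a, by ring⟩
      have hχ : χ ∈ Ioo (-(genPi a / 2)) (genPi a / 2) := ⟨by linarith, by linarith⟩
      have hc' := genCos_pos ha hχ
      have := hm hχ ⟨hφ.1, h0⟩ (by linarith)
      simp only at this
      have h2 : phaseJacobian a φ (χ + genPi a) = genCos a φ * genCos a χ *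
          ((genSin a φ / genCos a φ - φ) - (genSin a χ / genCos a χ - χ) + genPi a) := by
        unfold phaseJacobian
        rw [genCos_antiperiodic ha, genSin_antiperiodic ha]
        field_simp; ring
      rw [h2]
      exact mul_pos (mul_pos hc hc') (by linarith)

theorem phaseJacobian_ne_zero (ha : 1 ≤ a) {φ ω : ℝ} (h : 0 < |ω|) (h' : |ω| < genPi a) :
    phaseJacobian a φ (φ + ω) ≠ 0 := by
  rw [abs_lt] at h'
  rcases lt_or_gt_of_ne (abs_pos.1 h) with h0 | h0
  · have := phaseJacobian_pos ha (φ := φ + ω) (ψ := φ) (by linarith) (by linarith)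
    have h2 : phaseJacobian a φ (φ + ω) = -phaseJacobian a (φ + ω) φ := by
      unfold phaseJacobian; ring
    rw [h2]
    exact (neg_neg_of_pos this).ne
  · exact (phaseJacobian_pos ha (by linarith) (by linarith)).ne'

theorem phaseJacobian_eq_zero (ha : 1 ≤ a) {φ ω : ℝ} (h : |ω| = genPi a) (hφ : genCos a φ = 0) :
    phaseJacobian a φ (φ + ω) = 0 := by
  have : genCos a (φ + ω) = 0 := by
    rcases (abs_eq (genPi_pos ha).le).1 h with h | h
    · rw [h, genCos_antiperiodic ha, hφ, neg_zero]
    · rw [h, ← sub_eq_add_neg, (genCos_antiperiodic ha).sub_eq, hφ, neg_zero]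
  simp [phaseJacobian, hφ, this]

theorem hasDerivAt_genCot (ha : 1 ≤ a) {y : ℝ} (hy : y ∈ Ioo 0 (genPi a)) :
    HasDerivAt (fun y => genCos a y / genSin a y ^ a) (-(a / genSin a y ^ (a + 1))) y := by
  have hs := genSin_pos ha hy
  refine ((hasDerivAt_genCos ha y).fun_div ((hasDerivAt_genSin ha y).fun_pow a)
    (by positivity)).congr_deriv ?_
  obtain ⟨n, rfl⟩ : ∃ n, a = n + 1 := ⟨a - 1, by omega⟩
  have h := genCos_sq_add ha y
  have h1 : 2 * (n + 1) - 1 = 2 * n + 1 := by omega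
  rw [h1, Nat.add_sub_cancel, div_eq_iff (by positivity)]
  push_cast
  field_simp
  linear_combination (-genSin (n + 1) y ^ (2 * n + 2)) * h

theorem genCot_injOn (ha : 1 ≤ a) :
    InjOn (fun y => genCos a y / genSin a y ^ a) (Ioo 0 (genPi a)) := by
  refine (strictAntiOn_of_deriv_neg (convex_Ioo _ _) (fun y hy => ?_) fun y hy => ?_).injOn
  · exact (hasDerivAt_genCot ha hy).continuousAt.continuousWithinAt
  · rw [interior_Ioo] at hy
    have hs := genSin_pos ha hy
    have : (0 : ℝ) < a := by exact_mod_cast ha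
    rw [(hasDerivAt_genCot ha hy).deriv, neg_lt_zero]
    positivity

theorem exists_genCot_eq (ha : 1 ≤ a) (c : ℝ) :
    ∃ y ∈ Ioo 0 (genPi a), genCos a y / genSin a y ^ a = c := by
  have hc : 0 < 1 + c ^ 2 := by positivity
  set Y : ℝ := (1 / (1 + c ^ 2)) ^ ((1 : ℝ) / (2 * a : ℕ)) with hY
  have hYpos : 0 < Y := by positivity
  have hYp : Y ^ (2 * a) = 1 / (1 + c ^ 2) := by
    rw [hY, one_div ((2 * a : ℕ) : ℝ)]
    exact Real.rpow_inv_natCast_pow (by positivity) (by omega)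
  obtain ⟨y, hy, h1, h2⟩ := exists_genCos_genSin_of_nonneg ha (X := c * Y ^ a) hYpos.le (by
    rw [mul_pow, ← pow_mul, mul_comm a 2, hYp]; field_simp; ring)
  refine ⟨y, ⟨lt_of_le_of_ne hy.1 ?_, lt_of_le_of_ne hy.2 ?_⟩, ?_⟩
  · rintro rfl; rw [genSin_zero ha] at h2; linarith
  · rintro rfl; rw [genSin_pi ha] at h2; linarith
  · rw [h1, h2]; field_simp

/-- The inverse of `cos_a / sin_a ^ a : (0, π_a) → ℝ`. -/
def genArccot (a : ℕ) (c : ℝ) : ℝ :=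
  Function.invFunOn (fun y => genCos a y / genSin a y ^ a) (Ioo 0 (genPi a)) c

theorem genArccot_mem (ha : 1 ≤ a) (c : ℝ) : genArccot a c ∈ Ioo 0 (genPi a) :=
  Function.invFunOn_mem (exists_genCot_eq ha c)

theorem genCot_genArccot (ha : 1 ≤ a) (c : ℝ) :
    genCos a (genArccot a c) / genSin a (genArccot a c) ^ a = c :=
  Function.invFunOn_eq (exists_genCot_eq ha c)

theorem hasDerivAt_genArccot (ha : 1 ≤ a) (c : ℝ) :
    HasDerivAt (genArccot a) (-(genSin a (genArccot a c) ^ (a + 1) / a)) c := by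
  set f : ℝ → ℝ := fun y => genCos a y / genSin a y ^ a with hf
  set y := genArccot a c with hy
  have hmem : y ∈ Ioo 0 (genPi a) := genArccot_mem ha c
  have hfy : f y = c := genCot_genArccot ha c
  have hs := genSin_pos ha hmem
  have ha' : (0 : ℝ) < a := by exact_mod_cast ha
  have hstrict : HasStrictDerivAt f (-(a / genSin a y ^ (a + 1))) y := by
    refine hasStrictDerivAt_of_hasDerivAt_of_continuousAt
      (f' := fun y => -(a / genSin a y ^ (a + 1))) ?_ ?_
    · filter_upwards [Ioo_mem_nhds hmem.1 hmem.2] with z hz using hasDerivAt_genCot ha hz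
    · have := (continuous_genSin ha).continuousAt (x := y)
      exact (continuousAt_const.div (this.pow _) (pow_pos hs _).ne').neg
  have hne : -(a / genSin a y ^ (a + 1)) ≠ 0 := by
    rw [neg_ne_zero]; positivity
  have hinv := hstrict.to_local_left_inverse hne (g := genArccot a) (by
    filter_upwards [Ioo_mem_nhds hmem.1 hmem.2] with z hz
    exact genCot_injOn ha (genArccot_mem ha _) hz (genCot_genArccot ha _))
  rw [hfy] at hinv
  exact hinv.hasDerivAt.congr_deriv (by rw [inv_neg, inv_div])

end GenCurve

section Oscillator

theorem eq_of_hasDerivAt_of_contDiff {E : Type*} [NormedAddCommGroup E] [NormedSpace ℝ E]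
    {F : E → E} (hF : ContDiff ℝ 1 F) {f g : ℝ → E} (hf : ∀ t, HasDerivAt f (F (f t)) t)
    (hg : ∀ t, HasDerivAt g (F (g t)) t) (h0 : f 0 = g 0) : f = g := by
  ext t
  have hfc : Continuous f := continuous_iff_continuousAt.2 fun t => (hf t).continuousAt
  have hgc : Continuous g := continuous_iff_continuousAt.2 fun t => (hg t).continuousAt
  set T := |t| + 1
  have hT : 0 < T := by positivity
  obtain ⟨K, hK⟩ := LocallyLipschitzOn.exists_lipschitzOnWith_of_compact
    (((isCompact_Icc (a := -T) (b := T)).image hfc).union (isCompact_Icc.image hgc))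
    hF.locallyLipschitz.locallyLipschitzOn
  refine ODE_solution_unique_of_mem_Ioo (v := fun _ => F) (t₀ := 0) (a := -T) (b := T)
    (fun _ _ => hK) ⟨by linarith, hT⟩
    (fun s hs => ⟨hf s, Or.inl ⟨s, Ioo_subset_Icc_self hs, rfl⟩⟩)
    (fun s hs => ⟨hg s, Or.inr ⟨s, Ioo_subset_Icc_self hs, rfl⟩⟩) h0 ?_
  exact abs_lt.1 (lt_add_one |t|)

/-- `x` solves `x'' = -a k x^{2a-1}`, and `v = x'`. -/
structure IsOscillator (a : ℕ) (k : ℝ) (x v : ℝ → ℝ) : Prop where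
  hasDerivAt_pos : ∀ t, HasDerivAt x (v t) t
  hasDerivAt_vel : ∀ t, HasDerivAt v (-(a * k * x t ^ (2 * a - 1))) t

variable {a : ℕ} {k : ℝ}

namespace IsOscillator

variable {x v : ℝ → ℝ}

theorem continuous_pos (h : IsOscillator a k x v) : Continuous x :=
  continuous_iff_continuousAt.2 fun t => (h.hasDerivAt_pos t).continuousAt

theorem unique (h : IsOscillator a k x v) {x' v' : ℝ → ℝ} (h' : IsOscillator a k x' v')
    (hx : x 0 = x' 0) (hv : v 0 = v' 0) : x = x' ∧ v = v' := by
  have := eq_of_hasDerivAt_of_contDiff (E := ℝ × ℝ)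
    (F := fun p => (p.2, -(a * k * p.1 ^ (2 * a - 1)))) (by fun_prop)
    (f := fun t => (x t, v t)) (g := fun t => (x' t, v' t))
    (fun t => (h.hasDerivAt_pos t).prodMk (h.hasDerivAt_vel t))
    (fun t => (h'.hasDerivAt_pos t).prodMk (h'.hasDerivAt_vel t)) (by simp [hx, hv])
  exact ⟨funext fun t => congrArg Prod.fst (congrFun this t),
    funext fun t => congrArg Prod.snd (congrFun this t)⟩

theorem energy (h : IsOscillator a k x v) (t : ℝ) :
    v t ^ 2 + k * x t ^ (2 * a) = v 0 ^ 2 + k * x 0 ^ (2 * a) := by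
  have hd : ∀ t, HasDerivAt (fun t => v t ^ 2 + k * x t ^ (2 * a)) 0 t := by
    intro t
    refine (((h.hasDerivAt_vel t).fun_pow 2).fun_add
      (((h.hasDerivAt_pos t).fun_pow (2 * a)).const_mul k)).congr_deriv ?_
    push_cast
    ring
  exact is_const_of_deriv_eq_zero (fun t => (hd t).differentiableAt) (fun t => (hd t).deriv) t 0

theorem integral_eq (ha : 1 ≤ a) (h : IsOscillator a k x v) (t : ℝ) :
    (1 + a) * k * ∫ s in (0 : ℝ)..t, x s ^ (2 * a) =
      (v 0 ^ 2 + k * x 0 ^ (2 * a)) * t - x t * v t + x 0 * v 0 := by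
  have hd : ∀ s, HasDerivAt (fun s => (v 0 ^ 2 + k * x 0 ^ (2 * a)) * s - x s * v s)
      ((1 + a) * k * x s ^ (2 * a)) s := by
    intro s
    refine (((hasDerivAt_id' s).const_mul _).fun_sub
      ((h.hasDerivAt_pos s).fun_mul (h.hasDerivAt_vel s))).congr_deriv ?_
    rw [← h.energy s]
    obtain ⟨n, hn⟩ : ∃ n, 2 * a = n + 1 := ⟨2 * a - 1, by omega⟩
    rw [hn, Nat.add_sub_cancel]
    ring
  have hc := h.continuous_pos
  have := intervalIntegral.integral_eq_sub_of_hasDerivAt (a := 0) (b := t) (fun s _ => hd s)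
    (Continuous.intervalIntegrable (by fun_prop) _ _)
  rw [intervalIntegral.integral_const_mul] at this
  rw [this]
  ring

theorem comp_mul (h : IsOscillator a k x v) (c : ℝ) :
    IsOscillator a (c ^ 2 * k) (fun t => x (c * t)) (fun t => c * v (c * t)) where
  hasDerivAt_pos t := by
    have := HasDerivAt.comp t (h.hasDerivAt_pos (c * t)) ((hasDerivAt_id' t).const_mul c)
    refine this.congr_deriv ?_
    ring
  hasDerivAt_vel t := by
    have := (HasDerivAt.comp t (h.hasDerivAt_vel (c * t)) ((hasDerivAt_id' t).const_mul c)).const_mul c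
    refine this.congr_deriv ?_
    ring

end IsOscillator

theorem isOscillator_genSin (ha : 1 ≤ a) {A ω : ℝ} (φ : ℝ) (h : ω ^ 2 = k * A ^ (2 * a - 2)) :
    IsOscillator a k (fun t => A * genSin a (φ + ω * t)) (fun t => A * ω * genCos a (φ + ω * t)) where
  hasDerivAt_pos t := by
    have := (HasDerivAt.comp t (hasDerivAt_genSin ha (φ + ω * t))
      (((hasDerivAt_id' t).const_mul ω).const_add φ)).const_mul A
    refine this.congr_deriv ?_
    ring
  hasDerivAt_vel t := by
    have := (HasDerivAt.comp t (hasDerivAt_genCos ha (φ + ω * t))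
      (((hasDerivAt_id' t).const_mul ω).const_add φ)).const_mul (A * ω)
    refine this.congr_deriv ?_
    obtain ⟨n, hn⟩ : ∃ n, 2 * a = n + 2 := ⟨2 * a - 2, by omega⟩
    rw [hn, Nat.add_sub_cancel] at h
    have h1 : 2 * a - 1 = n + 1 := by omega
    rw [h1]
    linear_combination (-a * A * genSin a (φ + ω * t) ^ (n + 1)) * h

/-- The initial phase of the solution of `x'' = -a k x^{2a-1}`, `x(0) = x₀`, `x'(0) = u`. -/
def oscPhase (a : ℕ) (x₀ u k : ℝ) : ℝ := genArccot a (u / (x₀ * |x₀| ^ (a - 1) * Real.sqrt k))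

/-- The frequency of the solution of `x'' = -a k x^{2a-1}`, `x(0) = x₀`, `x'(0) = u`. -/
def oscFreq (a : ℕ) (x₀ u k : ℝ) : ℝ :=
  Real.sqrt k * |x₀| ^ (a - 1) / genSin a (oscPhase a x₀ u k) ^ (a - 1)

/-- The solution of `x'' = -a k x^{2a-1}`, `x(0) = x₀`, `x'(0) = u`, for `x₀ ≠ 0` and `0 ≤ k`. -/
def osc (a : ℕ) (x₀ u k t : ℝ) : ℝ :=
  if k = 0 then x₀ + u * t else
    x₀ / genSin a (oscPhase a x₀ u k) * genSin a (oscPhase a x₀ u k + oscFreq a x₀ u k * t)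

/-- The derivative of `osc a x₀ u k`. -/
def oscVel (a : ℕ) (x₀ u k t : ℝ) : ℝ :=
  if k = 0 then u else
    x₀ / genSin a (oscPhase a x₀ u k) * oscFreq a x₀ u k *
      genCos a (oscPhase a x₀ u k + oscFreq a x₀ u k * t)

/-- The integral of `osc a x₀ u k ^ (2 * a)`. -/
def oscInt (a : ℕ) (x₀ u k t : ℝ) : ℝ := ∫ s in (0 : ℝ)..t, osc a x₀ u k s ^ (2 * a)

variable {x₀ u : ℝ}

theorem genSin_oscPhase_pos (ha : 1 ≤ a) : 0 < genSin a (oscPhase a x₀ u k) :=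
  genSin_pos ha (genArccot_mem ha _)

theorem oscFreq_sq (ha : 1 ≤ a) (hk : 0 ≤ k) : oscFreq a x₀ u k ^ 2 =
    k * (x₀ / genSin a (oscPhase a x₀ u k)) ^ (2 * a - 2) := by
  have h : 2 * a - 2 = 2 * (a - 1) := by omega
  rw [oscFreq, div_pow, mul_pow, Real.sq_sqrt hk, div_pow, h, ← pow_mul, mul_comm (a - 1) 2,
    pow_mul |x₀|, sq_abs, ← pow_mul]
  ring

theorem isOscillator_osc (ha : 1 ≤ a) (hk : 0 ≤ k) :
    IsOscillator a k (osc a x₀ u k) (oscVel a x₀ u k) := by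
  rcases eq_or_ne k 0 with rfl | h0
  · constructor
    · intro t
      have : osc a x₀ u 0 = fun t => x₀ + u * t := by ext t; simp [osc]
      rw [this]
      refine (((hasDerivAt_id' t).const_mul u).const_add x₀).congr_deriv ?_
      simp [oscVel]
    · intro t
      have : oscVel a x₀ u 0 = fun t => u := by ext t; simp [oscVel]
      rw [this]
      simpa using hasDerivAt_const t u
  · have := isOscillator_genSin (k := k) ha (oscPhase a x₀ u k) (oscFreq_sq (x₀ := x₀) (u := u) ha hk)
    convert this using 1
    · ext t; simp [osc, h0]
    · ext t; simp [oscVel, h0]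

theorem osc_zero (ha : 1 ≤ a) : osc a x₀ u k 0 = x₀ := by
  unfold osc
  split_ifs
  · simp
  · have := (genSin_oscPhase_pos (x₀ := x₀) (u := u) (k := k) ha).ne'
    rw [mul_zero, add_zero]
    field_simp

theorem oscPhase_spec (ha : 1 ≤ a) (hx₀ : x₀ ≠ 0) (hk : 0 < k) :
    x₀ * oscFreq a x₀ u k * genCos a (oscPhase a x₀ u k) = u * genSin a (oscPhase a x₀ u k) := by
  have hs := genSin_oscPhase_pos (x₀ := x₀) (u := u) (k := k) ha
  have h1 := genCot_genArccot ha (u / (x₀ * |x₀| ^ (a - 1) * Real.sqrt k))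
  change genCos a (oscPhase a x₀ u k) / genSin a (oscPhase a x₀ u k) ^ a = _ at h1
  have hk' := Real.sqrt_pos.2 hk
  have hx' : 0 < |x₀| ^ (a - 1) := by positivity
  unfold oscFreq
  generalize genSin a (oscPhase a x₀ u k) = s at *
  generalize genCos a (oscPhase a x₀ u k) = c at *
  rw [div_eq_div_iff (by positivity) (by positivity)] at h1
  field_simp
  obtain ⟨n, rfl⟩ : ∃ n, a = n + 1 := ⟨a - 1, by omega⟩
  rw [Nat.add_sub_cancel] at *
  rw [pow_succ] at h1
  linear_combination h1

theorem oscVel_zero (ha : 1 ≤ a) (hx₀ : x₀ ≠ 0) (hk : 0 ≤ k) : oscVel a x₀ u k 0 = u := by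
  unfold oscVel
  split_ifs with h
  · rfl
  · have hs := genSin_oscPhase_pos (x₀ := x₀) (u := u) (k := k) ha
    rw [mul_zero, add_zero]
    have := oscPhase_spec (u := u) ha hx₀ (lt_of_le_of_ne hk (Ne.symm h))
    field_simp
    linarith

theorem IsOscillator.eq_osc (ha : 1 ≤ a) (hk : 0 ≤ k) {x v : ℝ → ℝ} (h : IsOscillator a k x v)
    (h0 : x 0 ≠ 0) : x = osc a (x 0) (v 0) k ∧ v = oscVel a (x 0) (v 0) k :=
  h.unique (isOscillator_osc ha hk) (osc_zero ha).symm (oscVel_zero ha h0 hk).symm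

theorem osc_mul (ha : 1 ≤ a) (hx₀ : x₀ ≠ 0) (hk : 0 ≤ k) (c t : ℝ) :
    osc a x₀ (c * u) (c ^ 2 * k) t = osc a x₀ u k (c * t) := by
  have h := (isOscillator_osc (x₀ := x₀) (u := u) ha hk).comp_mul c
  have h2 := (h.eq_osc ha (by positivity) (by simpa [osc_zero ha] using hx₀)).1
  have h3 := congrFun h2 t
  simp only [mul_zero, osc_zero ha, oscVel_zero ha hx₀ hk] at h3
  exact h3.symm

theorem osc_continuous (ha : 1 ≤ a) (hk : 0 ≤ k) : Continuous (osc a x₀ u k) :=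
  (isOscillator_osc ha hk).continuous_pos

theorem oscInt_mul (ha : 1 ≤ a) (hx₀ : x₀ ≠ 0) (hk : 0 ≤ k) (c t : ℝ) :
    c * oscInt a x₀ (c * u) (c ^ 2 * k) t = oscInt a x₀ u k (c * t) := by
  unfold oscInt
  simp_rw [osc_mul ha hx₀ hk]
  rw [← smul_eq_mul, intervalIntegral.smul_integral_comp_mul_left
    (f := fun s => osc a x₀ u k s ^ (2 * a)), mul_zero]

theorem hasDerivAt_oscInt (ha : 1 ≤ a) (hk : 0 ≤ k) (t : ℝ) :
    HasDerivAt (oscInt a x₀ u k) (osc a x₀ u k t ^ (2 * a)) t :=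
  (((osc_continuous ha hk).pow _).integral_hasStrictDerivAt 0 t).hasDerivAt

theorem oscInt_pos (ha : 1 ≤ a) (hx₀ : x₀ ≠ 0) (hk : 0 ≤ k) {t : ℝ} (ht : 0 < t) :
    0 < oscInt a x₀ u k t := by
  have hc := osc_continuous (x₀ := x₀) (u := u) ha hk
  refine intervalIntegral.integral_pos ht (by fun_prop) (fun s _ => ?_) ⟨0, ⟨le_rfl, ht.le⟩, ?_⟩
  · rw [pow_mul]; positivity
  · rw [osc_zero ha, pow_mul]; positivity

theorem exists_le_oscInt (ha : 1 ≤ a) (hx₀ : x₀ ≠ 0) (hk : 0 < k) (M : ℝ) :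
    ∃ t > 0, M ≤ oscInt a x₀ u k t := by
  have h := isOscillator_osc (x₀ := x₀) (u := u) ha hk.le
  have hu := oscVel_zero (u := u) ha hx₀ hk.le
  set E := u ^ 2 + k * x₀ ^ (2 * a) with hE
  have hpow : ∀ y : ℝ, 0 ≤ y ^ (2 * a) := fun y => by rw [pow_mul]; positivity
  have hEpos : 0 < E := by
    have : 0 < x₀ ^ (2 * a) := by rw [pow_mul]; positivity
    positivity
  have hb : ∀ t, osc a x₀ u k t * oscVel a x₀ u k t ≤ 1 + E / k + E := by
    intro t
    have he := h.energy t
    rw [hu, osc_zero ha, ← hE] at he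
    have h1 : osc a x₀ u k t ^ (2 * a) ≤ E / k := by
      rw [le_div_iff₀ hk]; nlinarith [sq_nonneg (oscVel a x₀ u k t)]
    have h2 : osc a x₀ u k t ^ 2 ≤ 1 + osc a x₀ u k t ^ (2 * a) := by
      rw [pow_mul]
      rcases le_or_gt (osc a x₀ u k t ^ 2) 1 with h | h
      · have := hpow (osc a x₀ u k t)
        rw [pow_mul] at this
        linarith
      · have := le_self_pow₀ h.le (by omega : a ≠ 0)
        linarith
    have h3 : oscVel a x₀ u k t ^ 2 ≤ E := by nlinarith [hpow (osc a x₀ u k t)]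
    nlinarith [sq_nonneg (osc a x₀ u k t - oscVel a x₀ u k t), sq_nonneg (oscVel a x₀ u k t),
      sq_nonneg (osc a x₀ u k t)]
  have hka : 0 < (1 + a) * k := by positivity
  set T := (|(1 + a) * k * M + (1 + E / k + E) - x₀ * u| + 1) / E with hT
  have hTpos : 0 < T := by positivity
  refine ⟨T, hTpos, ?_⟩
  have hi := h.integral_eq ha T
  rw [hu, osc_zero ha, ← hE] at hi
  have hET : E * T = |(1 + a) * k * M + (1 + E / k + E) - x₀ * u| + 1 := by
    rw [hT]; field_simp
  have h1 := hb T
  have h2 := le_abs_self ((1 + a) * k * M + (1 + E / k + E) - x₀ * u)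
  rw [← mul_le_mul_iff_right₀ hka]
  unfold oscInt
  linarith

end Oscillator

section OscillatorGradient

variable {a : ℕ} {k x₀ u : ℝ}

theorem hasFDerivAt_of_partial {f : ℝ × ℝ → ℝ} {p q : ℝ} {f₁ f₂ : ℝ}
    (hf : DifferentiableAt ℝ f (p, q)) (h₁ : HasDerivAt (fun s => f (s, q)) f₁ p)
    (h₂ : HasDerivAt (fun s => f (p, s)) f₂ q) :
    HasFDerivAt f (f₁ • ContinuousLinearMap.fst ℝ ℝ ℝ + f₂ • ContinuousLinearMap.snd ℝ ℝ ℝ)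
      (p, q) := by
  have hd := hf.hasFDerivAt
  have e₁ : fderiv ℝ f (p, q) (1, 0) = f₁ :=
    (hd.comp_hasDerivAt p ((hasDerivAt_id' p).prodMk (hasDerivAt_const p q))).unique h₁
  have e₂ : fderiv ℝ f (p, q) (0, 1) = f₂ :=
    (hd.comp_hasDerivAt q ((hasDerivAt_const q p).prodMk (hasDerivAt_id' q))).unique h₂
  refine hd.congr_fderiv ?_
  ext
  · simp [e₁]
  · simp [e₂]

theorem genSin_pow_mul (ha : 1 ≤ a) (y : ℝ) :
    genSin a y ^ (2 * a - 1) * genSin a y = 1 - genCos a y ^ 2 := by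
  rw [← pow_succ, Nat.sub_add_cancel (by omega), ← genCos_sq_add ha y, add_sub_cancel_left]

/-- `oscInt` at time `1`, for `0 < k`, in terms of the phase and the frequency. -/
theorem oscInt_one_eq (ha : 1 ≤ a) (hx₀ : x₀ ≠ 0) (hk : 0 < k) :
    oscInt a x₀ u k 1 = x₀ ^ 2 / (1 + a) *
      (oscFreq a x₀ u k * (oscFreq a x₀ u k -
        genSin a (oscPhase a x₀ u k + oscFreq a x₀ u k) *
          genCos a (oscPhase a x₀ u k + oscFreq a x₀ u k) +
        genSin a (oscPhase a x₀ u k) * genCos a (oscPhase a x₀ u k)) /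
          genSin a (oscPhase a x₀ u k) ^ 2 / k) := by
  have h := isOscillator_osc (x₀ := x₀) (u := u) ha hk.le
  have hi := h.integral_eq ha 1
  have hs := genSin_oscPhase_pos (x₀ := x₀) (u := u) (k := k) ha
  have hspec := oscPhase_spec (u := u) ha hx₀ hk
  have hfr := oscFreq_sq (x₀ := x₀) (u := u) ha hk.le
  have hcs := genCos_sq_add ha (oscPhase a x₀ u k)
  rw [oscVel_zero ha hx₀ hk.le, osc_zero ha] at hi
  change (1 + a) * k * oscInt a x₀ u k 1 = _ at hi
  simp only [osc, oscVel, if_neg hk.ne', mul_one] at hi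
  generalize oscInt a x₀ u k 1 = S at *
  generalize oscFreq a x₀ u k = Ω at *
  generalize oscPhase a x₀ u k = φ at *
  have hE : u ^ 2 + k * x₀ ^ (2 * a) = x₀ ^ 2 * Ω ^ 2 / genSin a φ ^ 2 := by
    have h1 : k * x₀ ^ (2 * a) = x₀ ^ 2 * Ω ^ 2 / genSin a φ ^ 2 * genSin a φ ^ (2 * a) := by
      rw [hfr]
      obtain ⟨n, hn⟩ : ∃ n, 2 * a = n + 2 := ⟨2 * a - 2, by omega⟩
      rw [hn, Nat.add_sub_cancel, div_pow]
      field_simp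
      ring
    have h2 : u = x₀ * Ω * genCos a φ / genSin a φ := by
      rw [hspec]; field_simp
    rw [h1, h2]
    field_simp
    linear_combination Ω ^ 2 * hcs
  rw [hE] at hi
  have h2 : u = x₀ * Ω * genCos a φ / genSin a φ := by
    rw [hspec]; field_simp
  rw [h2] at hi
  field_simp at hi ⊢
  linear_combination hi

theorem osc_one_eq (hk : 0 < k) : osc a x₀ u k 1 = x₀ * (genSin a (oscPhase a x₀ u k +
    oscFreq a x₀ u k) / genSin a (oscPhase a x₀ u k)) := by
  rw [osc, if_neg hk.ne', mul_one]; ring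

theorem hasDerivAt_genSin_add_div (ha : 1 ≤ a) {φ Ω : ℝ → ℝ} {φ' Ω' e : ℝ} (hφ : HasDerivAt φ φ' e)
    (hΩ : HasDerivAt Ω Ω' e) (hs : 0 < genSin a (φ e)) :
    HasDerivAt (fun e => x₀ * (genSin a (φ e + Ω e) / genSin a (φ e)))
      (x₀ * (genCos a (φ e + Ω e) * (φ' + Ω') / genSin a (φ e) -
        genSin a (φ e + Ω e) * genCos a (φ e) * φ' / genSin a (φ e) ^ 2)) e := by
  have h1 := HasDerivAt.comp e (hasDerivAt_genSin ha (φ e + Ω e)) (hφ.fun_add hΩ)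
  have h2 := HasDerivAt.comp e (hasDerivAt_genSin ha (φ e)) hφ
  refine ((h1.fun_div h2 hs.ne').const_mul x₀).congr_deriv ?_
  simp only [Function.comp]
  field_simp

theorem hasDerivAt_genSin_mul_genCos (ha : 1 ≤ a) {f : ℝ → ℝ} {f' e : ℝ} (hf : HasDerivAt f f' e) :
    HasDerivAt (fun e => genSin a (f e) * genCos a (f e))
      (((1 + a) * genCos a (f e) ^ 2 - a) * f') e := by
  refine ((HasDerivAt.comp e (hasDerivAt_genSin ha (f e)) hf).fun_mul
    (HasDerivAt.comp e (hasDerivAt_genCos ha (f e)) hf)).congr_deriv ?_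
  simp only [Function.comp]
  linear_combination (-a * f') * genSin_pow_mul ha (f e)

theorem hasDerivAt_oscInt_formula (ha : 1 ≤ a) {φ Ω κ : ℝ → ℝ} {φ' Ω' κ' e : ℝ}
    (hφ : HasDerivAt φ φ' e) (hΩ : HasDerivAt Ω Ω' e) (hκ : HasDerivAt κ κ' e)
    (hs : 0 < genSin a (φ e)) (hk : 0 < κ e) :
    HasDerivAt (fun e => x₀ ^ 2 / (1 + a) * (Ω e * (Ω e - genSin a (φ e + Ω e) * genCos a (φ e + Ω e) +
        genSin a (φ e) * genCos a (φ e)) / genSin a (φ e) ^ 2 / κ e))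
      (x₀ ^ 2 / (1 + a) * ((Ω' * (Ω e - genSin a (φ e + Ω e) * genCos a (φ e + Ω e) +
        genSin a (φ e) * genCos a (φ e)) +
        Ω e * (Ω' - ((1 + a) * genCos a (φ e + Ω e) ^ 2 - a) * (φ' + Ω') +
          ((1 + a) * genCos a (φ e) ^ 2 - a) * φ')) / genSin a (φ e) ^ 2 / κ e -
        Ω e * (Ω e - genSin a (φ e + Ω e) * genCos a (φ e + Ω e) +
        genSin a (φ e) * genCos a (φ e)) / genSin a (φ e) ^ 2 / κ e *
          (2 * genCos a (φ e) * φ' / genSin a (φ e) + κ' / κ e))) e := by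
  have hS := HasDerivAt.comp e (hasDerivAt_genSin ha (φ e)) hφ
  have hm := ((hΩ.fun_mul ((hΩ.fun_sub (hasDerivAt_genSin_mul_genCos ha (hφ.fun_add hΩ))).fun_add
    (hasDerivAt_genSin_mul_genCos ha hφ))).fun_div
    (hS.fun_pow 2) (by simpa using hs.ne')).fun_div hκ hk.ne'
  refine (hm.const_mul (x₀ ^ 2 / (1 + a))).congr_deriv ?_
  simp only [Function.comp]
  field_simp
  ring

theorem hasDerivAt_oscPhase_fst (ha : 1 ≤ a) (hx₀ : x₀ ≠ 0) (hk : 0 < k) :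
    HasDerivAt (fun u => oscPhase a x₀ u k)
      (-(genSin a (oscPhase a x₀ u k) ^ 2 / (a * x₀ * oscFreq a x₀ u k))) u := by
  have := HasDerivAt.comp u (hasDerivAt_genArccot ha (u / (x₀ * |x₀| ^ (a - 1) * Real.sqrt k)))
    ((hasDerivAt_id' u).div_const _)
  refine this.congr_deriv ?_
  have hs := genSin_oscPhase_pos (x₀ := x₀) (u := u) (k := k) ha
  change -(genSin a (oscPhase a x₀ u k) ^ (a + 1) / a) * _ = _
  unfold oscFreq
  have hk' := Real.sqrt_pos.2 hk
  have ha' : (0 : ℝ) < a := by exact_mod_cast ha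
  obtain ⟨n, hn⟩ : ∃ n, a = n + 1 := ⟨a - 1, by omega⟩
  have h1 : a - 1 = n := by omega
  have h2 : a + 1 = n + 2 := by omega
  rw [h1, h2]
  generalize genSin a (oscPhase a x₀ u k) = s at *
  have : 0 < |x₀| := by positivity
  field_simp
  ring

theorem hasDerivAt_oscPhase_snd (ha : 1 ≤ a) (hx₀ : x₀ ≠ 0) (hk : 0 < k) :
    HasDerivAt (fun k => oscPhase a x₀ u k)
      (genSin a (oscPhase a x₀ u k) * genCos a (oscPhase a x₀ u k) / (2 * a * k)) k := by
  have hk' := Real.sqrt_pos.2 hk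
  have hx' : 0 < |x₀| ^ (a - 1) := by positivity
  have := HasDerivAt.comp k (hasDerivAt_genArccot ha (u / (x₀ * |x₀| ^ (a - 1) * Real.sqrt k)))
    ((hasDerivAt_const k u).fun_div (((hasDerivAt_id' k).sqrt hk.ne').const_mul
      (x₀ * |x₀| ^ (a - 1))) (by positivity))
  refine this.congr_deriv ?_
  have hs := genSin_oscPhase_pos (x₀ := x₀) (u := u) (k := k) ha
  have h1 := genCot_genArccot ha (u / (x₀ * |x₀| ^ (a - 1) * Real.sqrt k))
  change genCos a (oscPhase a x₀ u k) / genSin a (oscPhase a x₀ u k) ^ a = _ at h1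
  change -(genSin a (oscPhase a x₀ u k) ^ (a + 1) / a) * _ = _
  have ha' : (0 : ℝ) < a := by exact_mod_cast ha
  have hq := Real.sq_sqrt hk.le
  generalize genSin a (oscPhase a x₀ u k) = s at *
  generalize genCos a (oscPhase a x₀ u k) = c at *
  generalize |x₀| ^ (a - 1) = B at *
  generalize Real.sqrt k = r at *
  rw [div_eq_div_iff (by positivity) (by positivity)] at h1
  rw [← hq]
  field_simp
  rw [pow_succ]
  linear_combination -s * h1

theorem hasDerivAt_oscFreq (ha : 1 ≤ a) {κ φ : ℝ → ℝ} {φ' κ' e B : ℝ}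
    (hφ : HasDerivAt φ φ' e) (hκ : HasDerivAt κ κ' e) (hs : 0 < genSin a (φ e)) (hk : 0 < κ e) :
    HasDerivAt (fun e => Real.sqrt (κ e) * B / genSin a (φ e) ^ (a - 1))
      (Real.sqrt (κ e) * B / genSin a (φ e) ^ (a - 1) *
        (κ' / (2 * κ e) - (a - 1) * (genCos a (φ e) / genSin a (φ e)) * φ')) e := by
  have hS := HasDerivAt.comp e (hasDerivAt_genSin ha (φ e)) hφ
  have hk' := Real.sqrt_pos.2 hk
  refine (((hκ.sqrt hk.ne').mul_const B).fun_div (hS.fun_pow (a - 1))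
    (pow_pos hs _).ne').congr_deriv ?_
  have hq := Real.sq_sqrt hk.le
  simp only [Function.comp]
  obtain ⟨n, rfl⟩ : ∃ n, a = n + 1 := ⟨a - 1, by omega⟩
  rw [Nat.add_sub_cancel]
  generalize Real.sqrt (κ e) = r at *
  rw [← hq]
  cases n with
  | zero => field_simp; simp; ring
  | succ n => rw [Nat.add_sub_cancel]; push_cast; field_simp; ring

end OscillatorGradient

section OscillatorGradient

variable {a : ℕ} {k x₀ u : ℝ}

theorem DifferentiableAt.fun_div_of_normed {E : Type*} [NormedAddCommGroup E] [NormedSpace ℝ E]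
    {f g : E → ℝ} {e : E} (hf : DifferentiableAt ℝ f e) (hg : DifferentiableAt ℝ g e)
    (h : g e ≠ 0) : DifferentiableAt ℝ (fun e => f e / g e) e := by
  simp_rw [div_eq_mul_inv]
  exact hf.fun_mul (hg.fun_inv h)

/-- The Jacobian determinant of the exponential map of a Grushin plane. -/
def oscJacobian (a : ℕ) (x₀ u k : ℝ) : ℝ :=
  if k = 0 then oscInt a x₀ u k 1 else
    (x₀ / genSin a (oscPhase a x₀ u k)) ^ 2 * oscFreq a x₀ u k / (a * k) *
      phaseJacobian a (oscPhase a x₀ u k) (oscPhase a x₀ u k + oscFreq a x₀ u k)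

theorem differentiableAt_oscPhase (ha : 1 ≤ a) (hx₀ : x₀ ≠ 0) (hk : 0 < k) :
    DifferentiableAt ℝ (fun p : ℝ × ℝ => oscPhase a x₀ p.1 p.2) (u, k) := by
  have hk' := Real.sqrt_pos.2 hk
  have hB : 0 < |x₀| ^ (a - 1) := by positivity
  refine DifferentiableAt.comp (u, k) (g := genArccot a)
    (f := fun p : ℝ × ℝ => p.1 / (x₀ * |x₀| ^ (a - 1) * Real.sqrt p.2))
    (hasDerivAt_genArccot ha _).differentiableAt ?_
  have hsq : DifferentiableAt ℝ (fun p : ℝ × ℝ => Real.sqrt p.2) (u, k) :=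
    differentiableAt_snd.sqrt (by exact hk.ne')
  refine differentiableAt_fst.fun_div_of_normed (hsq.const_mul _) ?_
  change x₀ * |x₀| ^ (a - 1) * Real.sqrt k ≠ 0
  positivity

theorem differentiableAt_oscFreq (ha : 1 ≤ a) (hx₀ : x₀ ≠ 0) (hk : 0 < k) :
    DifferentiableAt ℝ (fun p : ℝ × ℝ => oscFreq a x₀ p.1 p.2) (u, k) := by
  have hs := genSin_oscPhase_pos (x₀ := x₀) (u := u) (k := k) ha
  have hsq : DifferentiableAt ℝ (fun p : ℝ × ℝ => Real.sqrt p.2) (u, k) :=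
    differentiableAt_snd.sqrt (by exact hk.ne')
  have hS : DifferentiableAt ℝ (fun p : ℝ × ℝ => genSin a (oscPhase a x₀ p.1 p.2)) (u, k) :=
    DifferentiableAt.comp (u, k) (g := genSin a) (f := fun p : ℝ × ℝ => oscPhase a x₀ p.1 p.2)
      (hasDerivAt_genSin ha _).differentiableAt (differentiableAt_oscPhase ha hx₀ hk)
  exact (hsq.mul_const _).fun_div_of_normed (hS.fun_pow _) (by exact (pow_pos hs _).ne')

theorem oscFreq_pos (ha : 1 ≤ a) (hx₀ : x₀ ≠ 0) (hk : 0 < k) : 0 < oscFreq a x₀ u k := by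
  have hs := genSin_oscPhase_pos (x₀ := x₀) (u := u) (k := k) ha
  unfold oscFreq
  have := Real.sqrt_pos.2 hk
  positivity

/-- The gradients of the end point and of `oscInt`, for `0 < k`. -/
theorem exists_gradient_of_pos (ha : 1 ≤ a) (hx₀ : x₀ ≠ 0) (hk : 0 < k) :
    ∃ xu xk su sk : ℝ,
      HasFDerivAt (fun p : ℝ × ℝ => osc a x₀ p.1 p.2 1)
        (xu • ContinuousLinearMap.fst ℝ ℝ ℝ + xk • ContinuousLinearMap.snd ℝ ℝ ℝ) (u, k) ∧
      HasFDerivAt (fun p : ℝ × ℝ => oscInt a x₀ p.1 p.2 1)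
        (su • ContinuousLinearMap.fst ℝ ℝ ℝ + sk • ContinuousLinearMap.snd ℝ ℝ ℝ) (u, k) ∧
      xu * (oscInt a x₀ u k 1 + 2 * k * sk) - 2 * k * xk * su = oscJacobian a x₀ u k := by
  have hs := genSin_oscPhase_pos (x₀ := x₀) (u := u) (k := k) ha
  have hΩ := oscFreq_pos (u := u) ha hx₀ hk
  have ha' : (0 : ℝ) < a := by exact_mod_cast ha
  have dφ := differentiableAt_oscPhase (u := u) ha hx₀ hk
  have dΩ := differentiableAt_oscFreq (u := u) ha hx₀ hk
  have dS : DifferentiableAt ℝ (fun p : ℝ × ℝ => genSin a (oscPhase a x₀ p.1 p.2)) (u, k) :=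
    DifferentiableAt.comp (u, k) (g := genSin a) (f := fun p : ℝ × ℝ => oscPhase a x₀ p.1 p.2)
      (hasDerivAt_genSin ha _).differentiableAt dφ
  have dC : DifferentiableAt ℝ (fun p : ℝ × ℝ => genCos a (oscPhase a x₀ p.1 p.2)) (u, k) :=
    DifferentiableAt.comp (u, k) (g := genCos a) (f := fun p : ℝ × ℝ => oscPhase a x₀ p.1 p.2)
      (hasDerivAt_genCos ha _).differentiableAt dφ
  have dS1 : DifferentiableAt ℝ (fun p : ℝ × ℝ => genSin a (oscPhase a x₀ p.1 p.2 +
      oscFreq a x₀ p.1 p.2)) (u, k) :=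
    DifferentiableAt.comp (u, k) (g := genSin a)
      (f := fun p : ℝ × ℝ => oscPhase a x₀ p.1 p.2 + oscFreq a x₀ p.1 p.2)
      (hasDerivAt_genSin ha _).differentiableAt (dφ.fun_add dΩ)
  have dC1 : DifferentiableAt ℝ (fun p : ℝ × ℝ => genCos a (oscPhase a x₀ p.1 p.2 +
      oscFreq a x₀ p.1 p.2)) (u, k) :=
    DifferentiableAt.comp (u, k) (g := genCos a)
      (f := fun p : ℝ × ℝ => oscPhase a x₀ p.1 p.2 + oscFreq a x₀ p.1 p.2)
      (hasDerivAt_genCos ha _).differentiableAt (dφ.fun_add dΩ)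
  have hev : ∀ᶠ p : ℝ × ℝ in 𝓝 (u, k), 0 < p.2 := continuousAt_snd.eventually (lt_mem_nhds hk)
  have f₁ := hasDerivAt_oscPhase_fst (u := u) ha hx₀ hk
  have f₂ := hasDerivAt_oscPhase_snd (u := u) ha hx₀ hk
  have w₁ := hasDerivAt_oscFreq (B := |x₀| ^ (a - 1)) ha f₁ (hasDerivAt_const u k) hs hk
  have w₂ := hasDerivAt_oscFreq (B := |x₀| ^ (a - 1)) ha f₂ (hasDerivAt_id' k) hs hk
  have X := hasFDerivAt_of_partial (f := fun p : ℝ × ℝ => x₀ * (genSin a (oscPhase a x₀ p.1 p.2 +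
      oscFreq a x₀ p.1 p.2) / genSin a (oscPhase a x₀ p.1 p.2)))
    (p := u) (q := k) ((dS1.fun_div_of_normed dS (by exact hs.ne')).const_mul x₀) (hasDerivAt_genSin_add_div ha f₁ w₁ hs)
    (hasDerivAt_genSin_add_div ha f₂ w₂ hs)
  have S := hasFDerivAt_of_partial (f := fun p : ℝ × ℝ => x₀ ^ 2 / (1 + a) *
      (oscFreq a x₀ p.1 p.2 * (oscFreq a x₀ p.1 p.2 -
        genSin a (oscPhase a x₀ p.1 p.2 + oscFreq a x₀ p.1 p.2) *
          genCos a (oscPhase a x₀ p.1 p.2 + oscFreq a x₀ p.1 p.2) +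
        genSin a (oscPhase a x₀ p.1 p.2) * genCos a (oscPhase a x₀ p.1 p.2)) /
          genSin a (oscPhase a x₀ p.1 p.2) ^ 2 / p.2))
    (p := u) (q := k) ((((dΩ.fun_mul ((dΩ.fun_sub (dS1.fun_mul dC1)).fun_add (dS.fun_mul dC))).fun_div_of_normed
      (dS.fun_pow 2) (by exact (pow_pos hs 2).ne')).fun_div_of_normed
      differentiableAt_snd (by exact hk.ne')).const_mul _)
    (hasDerivAt_oscInt_formula ha f₁ w₁ (hasDerivAt_const u k) hs hk)
    (hasDerivAt_oscInt_formula ha f₂ w₂ (hasDerivAt_id' k) hs hk)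
  refine ⟨_, _, _, _, X.congr_of_eventuallyEq ?_, S.congr_of_eventuallyEq ?_, ?_⟩
  · filter_upwards [hev] with p hp using osc_one_eq hp
  · filter_upwards [hev] with p hp using oscInt_one_eq ha hx₀ hp
  · rw [oscInt_one_eq ha hx₀ hk, oscJacobian, if_neg hk.ne', phaseJacobian]
    have hfold : Real.sqrt k * |x₀| ^ (a - 1) / genSin a (oscPhase a x₀ u k) ^ (a - 1) =
      oscFreq a x₀ u k := rfl
    rw [hfold]
    have hspec := oscPhase_spec (u := u) ha hx₀ hk
    generalize oscFreq a x₀ u k = Ω at *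
    generalize oscPhase a x₀ u k = φ at *
    generalize genSin a (φ + Ω) = s1 at *
    generalize genCos a (φ + Ω) = c1 at *
    generalize genSin a φ = s at *
    generalize genCos a φ = c at *
    clear dφ dΩ dS dC dS1 dC1 hev f₁ f₂ w₁ w₂ X S
    field_simp
    ring

end OscillatorGradient

section OscillatorGradientZero

variable {a : ℕ} {k x₀ u : ℝ}

theorem abs_osc_sub_le (ha : 1 ≤ a) (hx₀ : x₀ ≠ 0) (u₀ : ℝ) : ∃ C : ℝ, ∀ u k : ℝ, |u - u₀| ≤ 1 → 0 ≤ k →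
    k ≤ 1 → |osc a x₀ u k 1 - osc a x₀ u 0 1| ≤ C * k ∧
      |oscInt a x₀ u k 1 - oscInt a x₀ u 0 1| ≤ C * k := by
  set V := Real.sqrt ((|u₀| + 1) ^ 2 + x₀ ^ (2 * a)) with hV
  set R := |x₀| + V with hR
  have hpow : ∀ y : ℝ, 0 ≤ y ^ (2 * a) := fun y => by rw [pow_mul]; positivity
  have hVnn : 0 ≤ V := Real.sqrt_nonneg _
  have hV2 : V ^ 2 = (|u₀| + 1) ^ 2 + x₀ ^ (2 * a) := Real.sq_sqrt (by have := hpow x₀; positivity)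
  have hRnn : 0 ≤ R := by positivity
  set C₁ := a * R ^ (2 * a - 1) with hC₁
  have hC₁nn : 0 ≤ C₁ := by positivity
  set C₂ := (2 * a : ℕ) * R ^ (2 * a - 1) with hC₂
  have hC₂nn : 0 ≤ C₂ := by positivity
  refine ⟨C₁ + C₁ * C₂, fun u k hu hk hk1 => ?_⟩
  have h := isOscillator_osc (x₀ := x₀) (u := u) ha hk
  have hv0 := oscVel_zero (u := u) ha hx₀ hk
  have hx0 := osc_zero (x₀ := x₀) (u := u) (k := k) ha
  have hu' : |u| ≤ |u₀| + 1 := by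
    have := abs_sub_abs_le_abs_sub u u₀
    linarith
  have hv : ∀ t, |oscVel a x₀ u k t| ≤ V := by
    intro t
    refine abs_le_of_sq_le_sq ?_ hVnn
    have he := h.energy t
    rw [hv0, hx0] at he
    have h1 : u ^ 2 ≤ (|u₀| + 1) ^ 2 := sq_le_sq' (by linarith [neg_abs_le u]) (by linarith [le_abs_self u])
    have h2 : 0 ≤ k * osc a x₀ u k t ^ (2 * a) := mul_nonneg hk (hpow _)
    have h3 : k * x₀ ^ (2 * a) ≤ x₀ ^ (2 * a) := mul_le_of_le_one_left (hpow _) hk1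
    linarith
  have hx : ∀ t ∈ Icc (0 : ℝ) 1, |osc a x₀ u k t| ≤ R := by
    intro t ht
    have := norm_image_sub_le_of_norm_deriv_le_segment' (f := osc a x₀ u k) (a := 0) (b := 1)
      (fun t _ => (h.hasDerivAt_pos t).hasDerivWithinAt) (fun t _ => hv t) t ht
    rw [hx0, Real.norm_eq_abs] at this
    have h1 := abs_sub_abs_le_abs_sub (osc a x₀ u k t) x₀
    nlinarith [ht.1, ht.2]
  have hdv : ∀ t ∈ Icc (0 : ℝ) 1, |oscVel a x₀ u k t - u| ≤ C₁ * k := by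
    intro t ht
    have := norm_image_sub_le_of_norm_deriv_le_segment' (f := oscVel a x₀ u k) (a := 0) (b := 1)
      (C := C₁ * k) (fun t _ => (h.hasDerivAt_vel t).hasDerivWithinAt) (fun t ht => ?_) t ht
    · rw [hv0, Real.norm_eq_abs] at this
      have : 0 ≤ C₁ * k := by positivity
      nlinarith [ht.1, ht.2]
    · rw [norm_neg, Real.norm_eq_abs, abs_mul, abs_mul, abs_pow, abs_of_nonneg hk, Nat.abs_cast,
        hC₁]
      have := pow_le_pow_left₀ (abs_nonneg _) (hx t (Ico_subset_Icc_self ht)) (2 * a - 1)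
      have h2 : (0 : ℝ) ≤ a * k := by positivity
      nlinarith
  have hzero : ∀ t, osc a x₀ u 0 t = x₀ + u * t := fun t => by simp [osc]
  have hdx : ∀ t ∈ Icc (0 : ℝ) 1, |osc a x₀ u k t - osc a x₀ u 0 t| ≤ C₁ * k := by
    intro t ht
    have := norm_image_sub_le_of_norm_deriv_le_segment'
      (f := fun t => osc a x₀ u k t - osc a x₀ u 0 t) (f' := fun t => oscVel a x₀ u k t - u)
      (a := 0) (b := 1) (C := C₁ * k) (fun t _ => ?_) (fun t ht => hdv t (Ico_subset_Icc_self ht)) t ht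
    · simp only [hx0, hzero, Real.norm_eq_abs, mul_zero, add_zero, sub_self, sub_zero] at this
      rw [hzero]
      have : 0 ≤ C₁ * k := by positivity
      nlinarith [ht.1, ht.2]
    · have h0 := (isOscillator_osc (x₀ := x₀) (u := u) ha le_rfl).hasDerivAt_pos t
      simp only [oscVel, if_true] at h0
      exact ((h.hasDerivAt_pos t).fun_sub h0).hasDerivWithinAt
  have hzR : ∀ t ∈ Icc (0 : ℝ) 1, |osc a x₀ u 0 t| ≤ R := by
    intro t ht
    rw [hzero]
    have h1 := abs_add_le x₀ (u * t)
    rw [abs_mul, abs_of_nonneg ht.1] at h1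
    have h2 : |u₀| + 1 ≤ V := Real.le_sqrt_of_sq_le (by linarith [hpow x₀])
    nlinarith [ht.1, ht.2, abs_nonneg u]
  constructor
  · have := hdx 1 ⟨zero_le_one, le_rfl⟩
    nlinarith [mul_nonneg (mul_nonneg hC₁nn hC₂nn) hk]
  · have hc := osc_continuous (x₀ := x₀) (u := u) ha hk
    have hc0 := osc_continuous (x₀ := x₀) (u := u) ha le_rfl
    unfold oscInt
    rw [← intervalIntegral.integral_sub (Continuous.intervalIntegrable (by fun_prop) _ _)
      (Continuous.intervalIntegrable (by fun_prop) _ _)]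
    have := intervalIntegral.norm_integral_le_of_norm_le_const (a := 0) (b := 1) (C := C₁ * C₂ * k)
      (f := fun s => osc a x₀ u k s ^ (2 * a) - osc a x₀ u 0 s ^ (2 * a)) (fun s hs => ?_)
    · rw [Real.norm_eq_abs, sub_zero, abs_one, mul_one] at this
      nlinarith [mul_nonneg hC₁nn hk]
    · rw [uIoc_of_le zero_le_one] at hs
      have hs' := Ioc_subset_Icc_self hs
      have h1 := abs_pow_sub_pow_le (osc a x₀ u k s) (osc a x₀ u 0 s) (2 * a)
      have h2 : max |osc a x₀ u k s| |osc a x₀ u 0 s| ^ (2 * a - 1) ≤ R ^ (2 * a - 1) :=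
        pow_le_pow_left₀ (by positivity) (max_le (hx s hs') (hzR s hs')) _
      rw [Real.norm_eq_abs]
      calc _ ≤ _ := h1
        _ ≤ (C₁ * k) * (2 * a : ℕ) * R ^ (2 * a - 1) := by
          gcongr
          exact hdx s hs'
        _ = C₁ * C₂ * k := by rw [hC₂]; ring

theorem differentiableAt_oscInt_zero : DifferentiableAt ℝ (fun u => oscInt a x₀ u 0 1) u := by
  have : (fun u => oscInt a x₀ u 0 1) = fun u : ℝ => ∑ m ∈ Finset.range (2 * a + 1),
      ∫ s in (0 : ℝ)..1, x₀ ^ m * (u ^ (2 * a - m) * s ^ (2 * a - m)) * ((2 * a).choose m : ℝ) := by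
    ext u
    unfold oscInt osc
    simp only [if_true, add_pow, mul_pow]
    refine intervalIntegral.integral_finsetSum fun m _ => ?_
    exact Continuous.intervalIntegrable (by fun_prop) _ _
  rw [this]
  simp only [intervalIntegral.integral_mul_const, intervalIntegral.integral_const_mul]
  fun_prop

theorem hasFDerivAt_of_abs_le {E : Type*} [NormedAddCommGroup E] [NormedSpace ℝ E] {f g q : E → ℝ}
    {f' : E →L[ℝ] ℝ} {e : E} {C : ℝ} (hf : HasFDerivAt f f' e)
    (hq : HasFDerivAt q (0 : E →L[ℝ] ℝ) e)
    (hqe : q e = 0) (h : ∀ᶠ e' in 𝓝 e, |g e' - f e'| ≤ C * q e') : HasFDerivAt g f' e := by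
  have hge : g e = f e := by
    have := h.self_of_nhds
    rw [hqe, mul_zero] at this
    exact sub_eq_zero.1 (abs_eq_zero.1 (le_antisymm this (abs_nonneg _)))
  have hd : HasFDerivAt (fun e => g e - f e) (0 : E →L[ℝ] ℝ) e := by
    rw [hasFDerivAt_iff_isLittleO] at hq ⊢
    simp only [hqe, hge, sub_self, sub_zero, zero_apply] at hq ⊢
    refine Asymptotics.IsBigO.trans_isLittleO (Asymptotics.IsBigO.of_bound |C| ?_) hq
    filter_upwards [h] with e' he'
    rw [Real.norm_eq_abs, Real.norm_eq_abs, ← abs_mul]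
    exact he'.trans (le_abs_self _)
  simpa using hd.fun_add hf

/-- The derivative of the end point and of `oscInt` when the initial velocity `u` and the
coefficient `k ≥ 0` depend on parameters. -/
theorem exists_gradient {E : Type*} [NormedAddCommGroup E] [NormedSpace ℝ E] (ha : 1 ≤ a)
    (hx₀ : x₀ ≠ 0) (hk : 0 ≤ k) : ∃ xu xk su sk : ℝ,
      (∀ (U q : E → ℝ) (U' q' : E →L[ℝ] ℝ) (e : E), (∀ e', 0 ≤ q e') → U e = u → q e = k →
        HasFDerivAt U U' e → HasFDerivAt q q' e →
        HasFDerivAt (fun e => osc a x₀ (U e) (q e) 1) (xu • U' + xk • q') e ∧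
        HasFDerivAt (fun e => oscInt a x₀ (U e) (q e) 1) (su • U' + sk • q') e) ∧
      xu * (oscInt a x₀ u k 1 + 2 * k * sk) - 2 * k * xk * su = oscJacobian a x₀ u k := by
  rcases eq_or_lt_of_le hk with rfl | hk
  · refine ⟨1, 0, deriv (fun u => oscInt a x₀ u 0 1) u, 0, ?_, by simp [oscJacobian]⟩
    intro U q U' q' e hq hU hqe dU dq
    have hq' : q' = 0 := IsLocalMin.hasFDerivAt_eq_zero
      (Eventually.of_forall fun e' => by rw [hqe]; exact hq e') dq
    subst hq'
    obtain ⟨C, hC⟩ := abs_osc_sub_le ha hx₀ u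
    have hev : ∀ᶠ e' in 𝓝 e, |U e' - u| ≤ 1 ∧ q e' ≤ 1 := by
      refine Eventually.and ?_ ?_
      · have := dU.continuousAt.eventually (Metric.closedBall_mem_nhds _ (zero_lt_one' ℝ))
        rwa [hU] at this
      · exact dq.continuousAt.eventually (ge_mem_nhds (by rw [hqe]; norm_num))
    have hosc : ∀ u : ℝ, osc a x₀ u 0 1 = x₀ + u := fun u => by simp [osc]
    simp only [smul_zero, add_zero]
    constructor
    · refine hasFDerivAt_of_abs_le (f := fun e => osc a x₀ (U e) 0 1) (C := C) ?_ dq hqe ?_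
      · simp only [hosc]
        rw [one_smul]
        exact dU.const_add x₀
      · filter_upwards [hev] with e' he' using (hC _ _ he'.1 (hq e') he'.2).1
    · refine hasFDerivAt_of_abs_le (f := fun e => oscInt a x₀ (U e) 0 1) (C := C) ?_ dq hqe ?_
      · have hd : HasDerivAt (fun u => oscInt a x₀ u 0 1) (deriv (fun u => oscInt a x₀ u 0 1) u)
            (U e) := by
          rw [hU]; exact differentiableAt_oscInt_zero.hasDerivAt
        exact hd.comp_hasFDerivAt e dU
      · filter_upwards [hev] with e' he' using (hC _ _ he'.1 (hq e') he'.2).2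
  · obtain ⟨xu, xk, su, sk, h1, h2, h3⟩ := exists_gradient_of_pos (u := u) ha hx₀ hk
    refine ⟨xu, xk, su, sk, ?_, h3⟩
    rintro U q U' q' e - rfl rfl dU dq
    have hU := dU.prodMk dq
    exact ⟨(HasFDerivAt.comp (g := fun p : ℝ × ℝ => osc a x₀ p.1 p.2 1) e h1 hU).congr_fderiv
      (by ext; simp), (HasFDerivAt.comp (g := fun p : ℝ × ℝ => oscInt a x₀ p.1 p.2 1) e h2
        hU).congr_fderiv (by ext; simp)⟩

end OscillatorGradientZero

section Geodesics

variable {α β : ℕ}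

theorem HasDerivAt.fst_of_prod {E F : Type*} [NormedAddCommGroup E] [NormedSpace ℝ E]
    [NormedAddCommGroup F] [NormedSpace ℝ F] {f : ℝ → E × F} {f' : E × F} {t : ℝ}
    (h : HasDerivAt f f' t) : HasDerivAt (fun s => (f s).1) f'.1 t :=
  (ContinuousLinearMap.fst ℝ E F).hasFDerivAt.comp_hasDerivAt t h

theorem HasDerivAt.snd_of_prod {E F : Type*} [NormedAddCommGroup E] [NormedSpace ℝ E]
    [NormedAddCommGroup F] [NormedSpace ℝ F] {f : ℝ → E × F} {f' : E × F} {t : ℝ}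
    (h : HasDerivAt f f' t) : HasDerivAt (fun s => (f s).2) f'.2 t :=
  (ContinuousLinearMap.snd ℝ E F).hasFDerivAt.comp_hasDerivAt t h

theorem grushinHamiltonian_eq (q p : ℝ × ℝ × ℝ) : grushinHamiltonian α β q p =
    1 / 2 * (p.1 ^ 2 + q.1 ^ (2 * α) * (p.2.1 ^ 2 + q.2.1 ^ (2 * β) * p.2.2 ^ 2)) := by
  simp only [grushinHamiltonian, covectorPairing, grushinFrame, Fin.sum_univ_three]
  simp
  ring

theorem IsRiemannianPoint.ne_zero {q : ℝ × ℝ × ℝ} (h : IsRiemannianPoint α β q) (hα : 1 ≤ α)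
    (hβ : 1 ≤ β) : q.1 ≠ 0 ∧ q.2.1 ≠ 0 := by
  have key : ∀ f : (ℝ × ℝ × ℝ) →ₗ[ℝ] ℝ, (∀ j, f (grushinFrame α β q j) = 0) → f = 0 := by
    intro f hf
    have hle : Submodule.span ℝ (Set.range (grushinFrame α β q)) ≤ LinearMap.ker f := by
      rw [Submodule.span_le]
      rintro _ ⟨j, rfl⟩
      exact hf j
    rw [IsRiemannianPoint] at h
    rw [h, top_le_iff] at hle
    exact LinearMap.ker_eq_top.1 hle
  constructor
  · intro h0
    have := key (LinearMap.fst ℝ ℝ ℝ ∘ₗ LinearMap.snd ℝ ℝ (ℝ × ℝ)) fun j => by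
      fin_cases j <;> simp [grushinFrame, h0]; omega
    have := congrArg (fun f => f (0, 1, 0)) this
    simp at this
  · intro h0
    have := key (LinearMap.snd ℝ ℝ ℝ ∘ₗ LinearMap.snd ℝ ℝ (ℝ × ℝ)) fun j => by
      fin_cases j <;> simp [grushinFrame, h0]; omega
    have := congrArg (fun f => f (0, 0, 1)) this
    simp at this

/-- The Hamiltonian vector field. -/
def grushinField (α β : ℕ) (s : (ℝ × ℝ × ℝ) × (ℝ × ℝ × ℝ)) : (ℝ × ℝ × ℝ) × (ℝ × ℝ × ℝ) :=
  ((s.2.1, s.1.1 ^ (2 * α) * s.2.2.1, s.1.1 ^ (2 * α) * s.1.2.1 ^ (2 * β) * s.2.2.2),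
   (-(α * s.1.1 ^ (2 * α - 1) * (s.2.2.1 ^ 2 + s.1.2.1 ^ (2 * β) * s.2.2.2 ^ 2)),
    -(β * s.1.1 ^ (2 * α) * s.1.2.1 ^ (2 * β - 1) * s.2.2.2 ^ 2), 0))

theorem isGrushinExtremal_iff {q p : ℝ → ℝ × ℝ × ℝ} : IsGrushinExtremal α β q p ↔
    ∀ t, HasDerivAt (fun s => (q s, p s)) (grushinField α β (q t, p t)) t := by
  have hx : ∀ q p : ℝ × ℝ × ℝ, deriv (fun u => grushinHamiltonian α β q (u, p.2.1, p.2.2)) p.1 =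
      (grushinField α β (q, p)).1.1 := by
    intro q p
    simp only [grushinHamiltonian_eq, grushinField]
    refine HasDerivAt.deriv ?_
    refine ((((hasDerivAt_id' p.1).fun_pow 2).add_const _).const_mul _).congr_deriv ?_
    ring
  have hy : ∀ q p : ℝ × ℝ × ℝ, deriv (fun v => grushinHamiltonian α β q (p.1, v, p.2.2)) p.2.1 =
      (grushinField α β (q, p)).1.2.1 := by
    intro q p
    simp only [grushinHamiltonian_eq, grushinField]
    refine HasDerivAt.deriv ?_
    refine (((((((hasDerivAt_id' p.2.1).fun_pow 2).add_const _).const_mul _).const_add _)).const_mul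
      _).congr_deriv ?_
    ring
  have hz : ∀ q p : ℝ × ℝ × ℝ, deriv (fun w => grushinHamiltonian α β q (p.1, p.2.1, w)) p.2.2 =
      (grushinField α β (q, p)).1.2.2 := by
    intro q p
    simp only [grushinHamiltonian_eq, grushinField]
    refine HasDerivAt.deriv ?_
    refine ((((((((hasDerivAt_id' p.2.2).fun_pow 2).const_mul _).const_add _)).const_mul _).const_add
      _).const_mul _).congr_deriv ?_
    ring
  have hu : ∀ q p : ℝ × ℝ × ℝ, -deriv (fun x => grushinHamiltonian α β (x, q.2.1, q.2.2) p) q.1 =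
      (grushinField α β (q, p)).2.1 := by
    intro q p
    simp only [grushinHamiltonian_eq, grushinField]
    rw [neg_inj]
    refine HasDerivAt.deriv ?_
    refine ((((((hasDerivAt_id' q.1).fun_pow (2 * α)).mul_const _)).const_add
      _).const_mul _).congr_deriv ?_
    push_cast
    ring
  have hv : ∀ q p : ℝ × ℝ × ℝ, -deriv (fun y => grushinHamiltonian α β (q.1, y, q.2.2) p) q.2.1 =
      (grushinField α β (q, p)).2.2.1 := by
    intro q p
    simp only [grushinHamiltonian_eq, grushinField]
    rw [neg_inj]
    refine HasDerivAt.deriv ?_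
    refine (((((((hasDerivAt_id' q.2.1).fun_pow (2 * β)).mul_const _).const_add _).const_mul
      _).const_add _).const_mul _).congr_deriv ?_
    push_cast
    ring
  have hw : ∀ q p : ℝ × ℝ × ℝ, -deriv (fun z => grushinHamiltonian α β (q.1, q.2.1, z) p) q.2.2 =
      (grushinField α β (q, p)).2.2.2 := by
    intro q p
    simp [grushinHamiltonian_eq, grushinField]
  constructor
  · intro h t
    have h1 := h.x_eq t; rw [hx] at h1
    have h2 := h.y_eq t; rw [hy] at h2
    have h3 := h.z_eq t; rw [hz] at h3
    have h4 := h.u_eq t; rw [hu] at h4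
    have h5 := h.v_eq t; rw [hv] at h5
    have h6 := h.w_eq t; rw [hw] at h6
    exact (h1.prodMk (h2.prodMk h3)).prodMk (h4.prodMk (h5.prodMk h6))
  · intro h
    have hq : ∀ t, HasDerivAt q (grushinField α β (q t, p t)).1 t := fun t =>
      HasDerivAt.fst_of_prod (h t)
    have hp : ∀ t, HasDerivAt p (grushinField α β (q t, p t)).2 t := fun t =>
      HasDerivAt.snd_of_prod (h t)
    have hq2 : ∀ t, HasDerivAt (fun s => (q s).2) (grushinField α β (q t, p t)).1.2 t := fun t =>
      HasDerivAt.snd_of_prod (hq t)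
    have hp2 : ∀ t, HasDerivAt (fun s => (p s).2) (grushinField α β (q t, p t)).2.2 t := fun t =>
      HasDerivAt.snd_of_prod (hp t)
    constructor
    · intro t; rw [hx]; exact HasDerivAt.fst_of_prod (hq t)
    · intro t; rw [hy]; exact HasDerivAt.fst_of_prod (hq2 t)
    · intro t; rw [hz]; exact HasDerivAt.snd_of_prod (hq2 t)
    · intro t; rw [hu]; exact HasDerivAt.fst_of_prod (hp t)
    · intro t; rw [hv]; exact HasDerivAt.fst_of_prod (hp2 t)
    · intro t; rw [hw]; exact HasDerivAt.snd_of_prod (hp2 t)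

theorem IsGrushinGeodesic.unique {q₀ p₀ : ℝ × ℝ × ℝ} {γ γ' : ℝ → ℝ × ℝ × ℝ}
    (h : IsGrushinGeodesic α β q₀ p₀ γ) (h' : IsGrushinGeodesic α β q₀ p₀ γ') : γ = γ' := by
  obtain ⟨p, hp, h0, hp0⟩ := h
  obtain ⟨p', hp', h0', hp0'⟩ := h'
  have := eq_of_hasDerivAt_of_contDiff (F := grushinField α β) (by unfold grushinField; fun_prop)
    (isGrushinExtremal_iff.1 hp) (isGrushinExtremal_iff.1 hp') (by simp [h0, h0', hp0, hp0'])
  exact funext fun t => congrArg Prod.fst (congrFun this t)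

theorem IsGrushinGeodesic.grushinGeodesic_eq {q₀ p₀ : ℝ × ℝ × ℝ} {γ : ℝ → ℝ × ℝ × ℝ}
    (h : IsGrushinGeodesic α β q₀ p₀ γ) : grushinGeodesic α β q₀ p₀ = γ := by
  have hex : ∃ γ, IsGrushinGeodesic α β q₀ p₀ γ := ⟨γ, h⟩
  rw [grushinGeodesic, dif_pos hex]
  exact hex.choose_spec.unique h

/-- The squared norm of `(v, w)` in the vertical directions, up to the factor `x ^ (2 * α)`. -/
def vertEnergy (β : ℕ) (q₀ p : ℝ × ℝ × ℝ) : ℝ := p.2.1 ^ 2 + q₀.2.1 ^ (2 * β) * p.2.2 ^ 2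

theorem vertEnergy_nonneg (q₀ p : ℝ × ℝ × ℝ) : 0 ≤ vertEnergy β q₀ p := by
  unfold vertEnergy; rw [pow_mul]; positivity

/-- The geodesic flow in terms of two oscillators. -/
def grushinPath (α β : ℕ) (q₀ p : ℝ × ℝ × ℝ) (t : ℝ) : ℝ × ℝ × ℝ :=
  (osc α q₀.1 p.1 (vertEnergy β q₀ p) t,
   osc β q₀.2.1 p.2.1 (p.2.2 ^ 2) (oscInt α q₀.1 p.1 (vertEnergy β q₀ p) t),
   q₀.2.2 + p.2.2 * oscInt β q₀.2.1 p.2.1 (p.2.2 ^ 2) (oscInt α q₀.1 p.1 (vertEnergy β q₀ p) t))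

theorem isGrushinGeodesic_grushinPath (hα : 1 ≤ α) (hβ : 1 ≤ β) {q₀ : ℝ × ℝ × ℝ} (hx : q₀.1 ≠ 0)
    (hy : q₀.2.1 ≠ 0) (p : ℝ × ℝ × ℝ) : IsGrushinGeodesic α β q₀ p (grushinPath α β q₀ p) := by
  have hk := vertEnergy_nonneg (β := β) q₀ p
  have hw : 0 ≤ p.2.2 ^ 2 := sq_nonneg _
  have hX := isOscillator_osc (x₀ := q₀.1) (u := p.1) hα hk
  have hY := isOscillator_osc (x₀ := q₀.2.1) (u := p.2.1) hβ hw
  have hσ := fun t => hasDerivAt_oscInt (x₀ := q₀.1) (u := p.1) hα hk t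
  have hZ := fun t => hasDerivAt_oscInt (x₀ := q₀.2.1) (u := p.2.1) hβ hw t
  have hσ0 : oscInt α q₀.1 p.1 (vertEnergy β q₀ p) 0 = 0 := by simp [oscInt]
  have hZ0 : oscInt β q₀.2.1 p.2.1 (p.2.2 ^ 2) 0 = 0 := by simp [oscInt]
  refine ⟨fun t => (oscVel α q₀.1 p.1 (vertEnergy β q₀ p) t,
    oscVel β q₀.2.1 p.2.1 (p.2.2 ^ 2) (oscInt α q₀.1 p.1 (vertEnergy β q₀ p) t), p.2.2),
    isGrushinExtremal_iff.2 fun t => ?_, ?_, ?_⟩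
  · have hE := hY.energy (oscInt α q₀.1 p.1 (vertEnergy β q₀ p) t)
    rw [oscVel_zero hβ hy hw, osc_zero hβ] at hE
    refine HasDerivAt.prodMk (HasDerivAt.prodMk ?_ (HasDerivAt.prodMk ?_ ?_))
      (HasDerivAt.prodMk ?_ (HasDerivAt.prodMk ?_ (hasDerivAt_const _ _)))
    · exact hX.hasDerivAt_pos t
    · refine (HasDerivAt.comp t (hY.hasDerivAt_pos _) (hσ t)).congr_deriv ?_
      exact mul_comm _ _
    · refine (((HasDerivAt.comp t (hZ _) (hσ t)).const_mul p.2.2).const_add q₀.2.2).congr_deriv ?_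
      simp only [grushinPath]
      ring
    · refine (hX.hasDerivAt_vel t).congr_deriv ?_
      have : vertEnergy β q₀ p = oscVel β q₀.2.1 p.2.1 (p.2.2 ^ 2)
          (oscInt α q₀.1 p.1 (vertEnergy β q₀ p) t) ^ 2 +
          osc β q₀.2.1 p.2.1 (p.2.2 ^ 2) (oscInt α q₀.1 p.1 (vertEnergy β q₀ p) t) ^ (2 * β) *
            p.2.2 ^ 2 := by
        nth_rewrite 1 [vertEnergy]
        linarith
      simp only [grushinPath]
      rw [← this]
      ring
    · refine (HasDerivAt.comp t (hY.hasDerivAt_vel _) (hσ t)).congr_deriv ?_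
      simp only [grushinPath]
      ring
  · simp [grushinPath, hσ0, hZ0, osc_zero hα, osc_zero hβ]
  · simp [hσ0, oscVel_zero hα hx hk, oscVel_zero hβ hy hw]

theorem grushinGeodesic_eq_path (hα : 1 ≤ α) (hβ : 1 ≤ β) {q₀ : ℝ × ℝ × ℝ} (hx : q₀.1 ≠ 0)
    (hy : q₀.2.1 ≠ 0) (p : ℝ × ℝ × ℝ) : grushinGeodesic α β q₀ p = grushinPath α β q₀ p :=
  (isGrushinGeodesic_grushinPath hα hβ hx hy p).grushinGeodesic_eq

theorem vertEnergy_smul (q₀ p : ℝ × ℝ × ℝ) (t : ℝ) :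
    vertEnergy β q₀ (t • p) = t ^ 2 * vertEnergy β q₀ p := by
  simp [vertEnergy]; ring

/-- The exponential map in terms of the end points of two oscillators. -/
theorem grushinExp_eq (hα : 1 ≤ α) (hβ : 1 ≤ β) {q₀ : ℝ × ℝ × ℝ} (hx : q₀.1 ≠ 0) (hy : q₀.2.1 ≠ 0)
    (p : ℝ × ℝ × ℝ) : grushinExp α β q₀ p =
      (osc α q₀.1 p.1 (vertEnergy β q₀ p) 1,
       osc β q₀.2.1 (oscInt α q₀.1 p.1 (vertEnergy β q₀ p) 1 * p.2.1)
        ((oscInt α q₀.1 p.1 (vertEnergy β q₀ p) 1 * p.2.2) ^ 2) 1,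
       q₀.2.2 + oscInt α q₀.1 p.1 (vertEnergy β q₀ p) 1 * p.2.2 *
        oscInt β q₀.2.1 (oscInt α q₀.1 p.1 (vertEnergy β q₀ p) 1 * p.2.1)
          ((oscInt α q₀.1 p.1 (vertEnergy β q₀ p) 1 * p.2.2) ^ 2) 1) := by
  rw [grushinExp, grushinGeodesic_eq_path hα hβ hx hy, grushinPath]
  set S := oscInt α q₀.1 p.1 (vertEnergy β q₀ p) 1
  rw [mul_pow, osc_mul hβ hy (sq_nonneg _), mul_right_comm, oscInt_mul hβ hy (sq_nonneg _), mul_one,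
    mul_comm p.2.2]

theorem grushinExp_smul (hα : 1 ≤ α) (hβ : 1 ≤ β) {q₀ : ℝ × ℝ × ℝ} (hx : q₀.1 ≠ 0) (hy : q₀.2.1 ≠ 0)
    (p : ℝ × ℝ × ℝ) (t : ℝ) : grushinExp α β q₀ (t • p) = grushinGeodesic α β q₀ p t := by
  rw [grushinExp_eq hα hβ hx hy, grushinGeodesic_eq_path hα hβ hx hy, grushinPath, vertEnergy_smul]
  have hk := vertEnergy_nonneg (β := β) q₀ p
  have h1 := oscInt_mul (u := p.1) hα hx hk t 1
  simp only [Prod.smul_fst, Prod.smul_snd, smul_eq_mul]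
  rw [osc_mul hα hx hk, mul_one]
  rw [mul_one] at h1
  simp only [← mul_assoc, mul_comm _ t, h1]
  set S := oscInt α q₀.1 p.1 (vertEnergy β q₀ p) t
  rw [mul_pow, osc_mul hβ hy (sq_nonneg _), mul_right_comm, oscInt_mul hβ hy (sq_nonneg _), mul_one,
    mul_comm p.2.2]

end Geodesics

section Jacobian

variable {α β : ℕ}

theorem exists_ne_zero_of_det_eq_zero {a b c d : ℝ} (h : a * d - b * c = 0) :
    ∃ x y : ℝ, (x ≠ 0 ∨ y ≠ 0) ∧ a * x + b * y = 0 ∧ c * x + d * y = 0 := by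
  by_cases h1 : d = 0 ∧ c = 0
  · by_cases h2 : b = 0 ∧ a = 0
    · exact ⟨1, 0, Or.inl one_ne_zero, by simp [h2.2], by simp [h1.2]⟩
    · refine ⟨b, -a, ?_, by ring, by simp [h1.1, h1.2]⟩
      rw [neg_ne_zero]; tauto
  · refine ⟨d, -c, ?_, by linarith, by ring⟩
    rw [neg_ne_zero]; tauto

theorem HasFDerivAt.fun_sq {E : Type*} [NormedAddCommGroup E] [NormedSpace ℝ E] {f : E → ℝ}
    {f' : E →L[ℝ] ℝ} {e : E} (h : HasFDerivAt f f' e) :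
    HasFDerivAt (fun e => f e ^ 2) ((2 * f e) • f') e := by
  simp_rw [sq]
  exact (h.fun_mul h).congr_fderiv (by rw [← add_smul, two_mul])

theorem exists_hasFDerivAt_grushinExp (hα : 1 ≤ α) (hβ : 1 ≤ β) {q₀ : ℝ × ℝ × ℝ} (hx : q₀.1 ≠ 0)
    (hy : q₀.2.1 ≠ 0) (p : ℝ × ℝ × ℝ) : ∃ L : (ℝ × ℝ × ℝ) →L[ℝ] (ℝ × ℝ × ℝ),
      HasFDerivAt (grushinExp α β q₀) L p ∧
      (Function.Surjective L ↔ oscJacobian α q₀.1 p.1 (vertEnergy β q₀ p) ≠ 0 ∧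
        oscJacobian β q₀.2.1 (oscInt α q₀.1 p.1 (vertEnergy β q₀ p) 1 * p.2.1)
          ((oscInt α q₀.1 p.1 (vertEnergy β q₀ p) 1 * p.2.2) ^ 2) ≠ 0) := by
  have hκ := vertEnergy_nonneg (β := β) q₀
  let U' : (ℝ × ℝ × ℝ) →L[ℝ] ℝ := ContinuousLinearMap.fst ℝ ℝ (ℝ × ℝ)
  let V' : (ℝ × ℝ × ℝ) →L[ℝ] ℝ :=
    (ContinuousLinearMap.fst ℝ ℝ ℝ).comp (ContinuousLinearMap.snd ℝ ℝ (ℝ × ℝ))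
  let W' : (ℝ × ℝ × ℝ) →L[ℝ] ℝ :=
    (ContinuousLinearMap.snd ℝ ℝ ℝ).comp (ContinuousLinearMap.snd ℝ ℝ (ℝ × ℝ))
  have dU : HasFDerivAt (fun p : ℝ × ℝ × ℝ => p.1) U' p := U'.hasFDerivAt
  have dV : HasFDerivAt (fun p : ℝ × ℝ × ℝ => p.2.1) V' p := V'.hasFDerivAt
  have dW : HasFDerivAt (fun p : ℝ × ℝ × ℝ => p.2.2) W' p := W'.hasFDerivAt
  set c := q₀.2.1 ^ (2 * β) with hc
  let K' : (ℝ × ℝ × ℝ) →L[ℝ] ℝ := (2 * p.2.1) • V' + (2 * c * p.2.2) • W'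
  have dK : HasFDerivAt (vertEnergy β q₀) K' p := by
    refine (dV.fun_sq.fun_add (dW.fun_sq.const_mul c)).congr_fderiv ?_
    ext <;> simp [K'] <;> ring
  obtain ⟨xu, xk, su, sk, hd, hD⟩ := exists_gradient (E := ℝ × ℝ × ℝ) (u := p.1) hα hx (hκ p)
  obtain ⟨dX, dS⟩ := hd _ _ _ _ p hκ rfl rfl dU dK
  have hSpos : 0 < oscInt α q₀.1 p.1 (vertEnergy β q₀ p) 1 := oscInt_pos hα hx (hκ p) one_pos
  set S := oscInt α q₀.1 p.1 (vertEnergy β q₀ p) 1 with hS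
  have dA := dS.fun_mul dV
  have dB := dS.fun_mul dW
  obtain ⟨yu, yk, tu, tk, he, hE⟩ := exists_gradient (E := ℝ × ℝ × ℝ) (u := S * p.2.1)
    (k := (S * p.2.2) ^ 2) hβ hy (sq_nonneg _)
  obtain ⟨dY, dT⟩ := he _ (fun e => (oscInt α q₀.1 e.1 (vertEnergy β q₀ e) 1 * e.2.2) ^ 2) _ _ p
    (fun e => sq_nonneg _) rfl rfl dA dB.fun_sq
  have dZ := (dB.fun_mul dT).const_add q₀.2.2
  have dexp := (dX.prodMk (dY.prodMk dZ)).congr_of_eventuallyEq (f₁ := grushinExp α β q₀)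
    (Eventually.of_forall fun p => grushinExp_eq hα hβ hx hy p)
  rw [← hD, ← hE]
  set T := oscInt β q₀.2.1 (S * p.2.1) ((S * p.2.2) ^ 2) 1
  set κ := vertEnergy β q₀ p with hκdef
  have hκeq : κ = p.2.1 ^ 2 + c * p.2.2 ^ 2 := rfl
  obtain ⟨L, hL⟩ : ∃ L, HasFDerivAt (grushinExp α β q₀) L p ∧ ∀ δ : ℝ × ℝ × ℝ,
      ∀ ε A B : ℝ, ε = 2 * p.2.1 * δ.2.1 + 2 * c * p.2.2 * δ.2.2 →
      A = S * δ.2.1 + p.2.1 * (su * δ.1 + sk * ε) → B = S * δ.2.2 + p.2.2 * (su * δ.1 + sk * ε) →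
      L δ = (xu * δ.1 + xk * ε, yu * A + 2 * (S * p.2.2) * yk * B,
        S * p.2.2 * (tu * A + 2 * (S * p.2.2) * tk * B) + T * B) := by
    refine ⟨_, dexp, ?_⟩
    rintro δ ε A B rfl rfl rfl
    change (_, _, _) = _
    simp only [Prod.mk.injEq]
    refine ⟨rfl, ?_, ?_⟩
    · simp [U', V', W', K']
      ring
    · simp [U', V', W', K']
      ring
  refine ⟨L, hL.1, ?_⟩
  replace hL := hL.2
  constructor
  · intro hsurj
    constructor
    · intro h0
      have hinj : Function.Injective L :=
        (LinearMap.injective_iff_surjective (f := (L : (ℝ × ℝ × ℝ) →ₗ[ℝ] (ℝ × ℝ × ℝ)))).2 hsurj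
      have hκ0 : κ ≠ 0 := by
        intro hκ0
        rw [hD, hκ0, oscJacobian, if_pos rfl] at h0
        rw [hS, hκ0] at hSpos
        exact hSpos.ne' h0
      obtain ⟨x, y, hxy, h1, h2⟩ := exists_ne_zero_of_det_eq_zero (a := xu) (b := 2 * κ * xk)
        (c := su) (d := S + 2 * κ * sk) (by linarith)
      have hker := hL (x, y * p.2.1, y * p.2.2) (2 * κ * y) 0 0 (by rw [hκeq]; ring)
        (by simp only; linear_combination -p.2.1 * h2) (by simp only; linear_combination -p.2.2 * h2)
      have hzero : L (x, y * p.2.1, y * p.2.2) = 0 := by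
        rw [hker]
        simp only [mul_zero, add_zero, Prod.mk_eq_zero, and_true]
        linarith
      have := hinj (hzero.trans (map_zero L).symm)
      simp only [Prod.mk_eq_zero, mul_eq_zero] at this
      obtain ⟨hx0, hv, hw⟩ := this
      have hy0 : y ≠ 0 := by tauto
      have hv' : p.2.1 = 0 := by tauto
      have hw' : p.2.2 = 0 := by tauto
      exact hκ0 (by rw [hκeq, hv', hw']; ring)
    · intro h0
      obtain ⟨δ₁, h1⟩ := hsurj (0, 1, 0)
      obtain ⟨δ₂, h2⟩ := hsurj (0, 0, 1)
      rw [hL δ₁ _ _ _ rfl rfl rfl] at h1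
      rw [hL δ₂ _ _ _ rfl rfl rfl] at h2
      simp only [Prod.mk.injEq] at h1 h2
      obtain ⟨-, a1, a2⟩ := h1
      obtain ⟨-, b1, b2⟩ := h2
      generalize S * δ₁.2.1 + _ = A₁ at a1 a2
      generalize S * δ₂.2.1 + _ = A₂ at b1 b2
      generalize S * δ₁.2.2 + _ = B₁ at a1 a2
      generalize S * δ₂.2.2 + _ = B₂ at b1 b2
      have : (1 : ℝ) = 0 := by
        linear_combination (A₁ * B₂ - A₂ * B₁) * h0 + (yu * A₂ + 2 * (S * p.2.2) * yk * B₂) * a2 -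
          (S * p.2.2 * (tu * A₂ + 2 * (S * p.2.2) * tk * B₂) + T * B₂) * a1 - b2
      exact one_ne_zero this
  · rintro ⟨h1, h2⟩
    refine (LinearMap.injective_iff_surjective (f := (L : (ℝ × ℝ × ℝ) →ₗ[ℝ] (ℝ × ℝ × ℝ)))).1 ?_
    refine (injective_iff_map_eq_zero _).2 fun δ hδ => ?_
    change L δ = 0 at hδ
    set ε := 2 * p.2.1 * δ.2.1 + 2 * c * p.2.2 * δ.2.2 with hε
    set A := S * δ.2.1 + p.2.1 * (su * δ.1 + sk * ε) with hA
    set B := S * δ.2.2 + p.2.2 * (su * δ.1 + sk * ε) with hB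
    rw [hL δ ε A B rfl rfl rfl] at hδ
    simp only [Prod.mk_eq_zero] at hδ
    obtain ⟨e1, e2, e3⟩ := hδ
    have hA0 : A = 0 := by
      refine (mul_eq_zero.1 ?_).resolve_left h2
      linear_combination (T + 2 * (S * p.2.2) ^ 2 * tk) * e2 - 2 * (S * p.2.2) * yk * e3
    have hB0 : B = 0 := by
      refine (mul_eq_zero.1 ?_).resolve_left h2
      linear_combination yu * e3 - (S * p.2.2) * tu * e2
    rw [hA] at hA0
    rw [hB] at hB0
    have e4 : (S + 2 * κ * sk) * ε + 2 * κ * su * δ.1 = 0 := by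
      rw [hκeq]
      linear_combination 2 * p.2.1 * hA0 + 2 * c * p.2.2 * hB0 + S * hε
    have hε0 : ε = 0 := by
      refine (mul_eq_zero.1 ?_).resolve_left h1
      linear_combination xu * e4 - 2 * κ * su * e1
    have hu0 : δ.1 = 0 := by
      refine (mul_eq_zero.1 ?_).resolve_left h1
      linear_combination (S + 2 * κ * sk) * e1 - xk * e4
    rw [hε0, hu0] at hA0 hB0
    have hv0 : δ.2.1 = 0 := by
      refine (mul_eq_zero.1 ?_).resolve_left hSpos.ne'
      linarith
    have hw0 : δ.2.2 = 0 := by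
      refine (mul_eq_zero.1 ?_).resolve_left hSpos.ne'
      linarith
    exact Prod.ext hu0 (Prod.ext hv0 hw0)

end Jacobian

section Phases

variable {a : ℕ} {k x₀ u : ℝ}

theorem oscJacobian_eq (ha : 1 ≤ a) (hx₀ : x₀ ≠ 0) (hk : 0 < k) :
    a * k * oscJacobian a x₀ u k =
      u * osc a x₀ u k 1 - x₀ * oscVel a x₀ u k 1 - u * oscVel a x₀ u k 1 := by
  have hs := genSin_oscPhase_pos (x₀ := x₀) (u := u) (k := k) ha
  have hspec := oscPhase_spec (u := u) ha hx₀ hk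
  have ha' : (0 : ℝ) < a := by exact_mod_cast ha
  rw [oscJacobian, if_neg hk.ne', osc, if_neg hk.ne', oscVel, if_neg hk.ne', phaseJacobian]
  simp only [mul_one]
  have h2 : u = x₀ * oscFreq a x₀ u k * genCos a (oscPhase a x₀ u k) /
      genSin a (oscPhase a x₀ u k) := by
    rw [hspec]; field_simp
  generalize oscFreq a x₀ u k = Ω at *
  generalize oscPhase a x₀ u k = φ at *
  rw [h2]
  field_simp
  ring

/-- The Jacobian in terms of any representation `A sin_a (φ + ω t)` of the oscillator. -/
theorem oscJacobian_phase (ha : 1 ≤ a) (hk : 0 < k) {A ω φ : ℝ} (h : ω ^ 2 = k * A ^ (2 * a - 2))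
    (h0 : A * genSin a φ ≠ 0) :
    a * k * oscJacobian a (A * genSin a φ) (A * ω * genCos a φ) k =
      A ^ 2 * ω * phaseJacobian a φ (φ + ω) := by
  have hosc := isOscillator_genSin (k := k) ha φ h
  have he := hosc.eq_osc ha hk.le (by simpa using h0)
  have h1 := congrFun he.1 1
  have h2 := congrFun he.2 1
  simp only [mul_zero, add_zero, mul_one] at h1 h2
  rw [oscJacobian_eq ha h0 hk, ← h1, ← h2, phaseJacobian]
  ring

theorem oscJacobian_ne_zero (ha : 1 ≤ a) (hk : 0 < k) {A ω φ : ℝ} (h : ω ^ 2 = k * A ^ (2 * a - 2))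
    (h0 : A * genSin a φ ≠ 0) (hω : 0 < |ω|) (hω' : |ω| < genPi a) :
    oscJacobian a (A * genSin a φ) (A * ω * genCos a φ) k ≠ 0 := by
  intro hz
  have := oscJacobian_phase ha hk h h0
  rw [hz, mul_zero] at this
  have h1 := phaseJacobian_ne_zero ha (φ := φ) hω hω'
  have h2 : A ≠ 0 := left_ne_zero_of_mul h0
  have h3 : ω ≠ 0 := abs_pos.1 hω
  exact (by positivity : A ^ 2 * ω * phaseJacobian a φ (φ + ω) ≠ 0) this.symm

theorem oscJacobian_eq_zero (ha : 1 ≤ a) (hk : 0 < k) {A ω φ : ℝ} (h : ω ^ 2 = k * A ^ (2 * a - 2))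
    (h0 : A * genSin a φ ≠ 0) (hω : |ω| = genPi a) (hφ : genCos a φ = 0) :
    oscJacobian a (A * genSin a φ) (A * ω * genCos a φ) k = 0 := by
  have := oscJacobian_phase ha hk h h0
  rw [phaseJacobian_eq_zero ha hω hφ, mul_zero] at this
  have ha' : (0 : ℝ) < a := by exact_mod_cast ha
  exact (mul_eq_zero.1 this).resolve_left (by positivity)

theorem oscJacobian_zero_ne_zero (ha : 1 ≤ a) (hx₀ : x₀ ≠ 0) : oscJacobian a x₀ u 0 ≠ 0 := by
  rw [oscJacobian, if_pos rfl]
  exact (oscInt_pos ha hx₀ le_rfl one_pos).ne'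

theorem genRho_sq (ha : 1 ≤ a) (x : ℝ) : genRho a x ^ 2 = x ^ (2 * a) := by
  obtain ⟨n, rfl⟩ : ∃ n, a = n + 1 := ⟨a - 1, by omega⟩
  rw [genRho, Nat.add_sub_cancel, mul_pow, ← pow_mul, mul_comm n 2, pow_mul, sq_abs, ← pow_mul]
  ring

theorem genRho_eq_zero_iff {x : ℝ} : genRho a x = 0 ↔ x = 0 := by
  constructor
  · intro h
    rcases mul_eq_zero.1 h with h | h
    · exact abs_eq_zero.1 (eq_zero_of_pow_eq_zero h)
    · exact h
  · rintro rfl; simp [genRho]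

theorem exists_genRho_eq (ha : 1 ≤ a) (c : ℝ) : ∃ x : ℝ, genRho a x = c := by
  have hc : 0 ≤ |c| := abs_nonneg c
  set y := |c| ^ ((a : ℝ)⁻¹) with hy
  have hyn : 0 ≤ y := by positivity
  have hya : y ^ a = |c| := Real.rpow_inv_natCast_pow hc (by omega)
  have h1 : genRho a y = |c| := by
    rw [genRho, abs_of_nonneg hyn, ← pow_succ, Nat.sub_add_cancel ha, hya]
  rcases le_total 0 c with h | h
  · exact ⟨y, by rw [h1, abs_of_nonneg h]⟩
  · refine ⟨-y, ?_⟩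
    rw [abs_of_nonpos h] at h1
    simp only [genRho, abs_neg, mul_neg] at h1 ⊢
    rw [h1, neg_neg]

end Phases

section Coordinates

variable {α β : ℕ} {q₀ : ℝ × ℝ × ℝ}

theorem exists_sphericalCovector_eq (hα : 1 ≤ α) (hβ : 1 ≤ β) (hx : q₀.1 ≠ 0) (hy : q₀.2.1 ≠ 0)
    {p : ℝ × ℝ × ℝ} (hp : grushinHamiltonian α β q₀ p = 1 / 2) :
    ∃ φ ∈ sphericalDomain α β, sphericalCovector α β q₀ φ = p := by
  rw [grushinHamiltonian_eq] at hp
  have hk := vertEnergy_nonneg (β := β) q₀ p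
  change 1 / 2 * (p.1 ^ 2 + q₀.1 ^ (2 * α) * vertEnergy β q₀ p) = 1 / 2 at hp
  obtain ⟨y, hy'⟩ := exists_genRho_eq hα (Real.sqrt (vertEnergy β q₀ p))
  have hyk : y ^ (2 * α) = vertEnergy β q₀ p := by
    rw [← genRho_sq hα, hy', Real.sq_sqrt hk]
  obtain ⟨φ₁, hφ₁, hc, hs⟩ := exists_genCos_genSin_of_nonneg hα (X := p.1) (Y := |q₀.1 * y|)
    (abs_nonneg _) (by rw [pow_mul, sq_abs, ← pow_mul, mul_pow, hyk]; linarith)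
  have hρ : genRho α (genSin α φ₁ / q₀.1) ^ 2 = vertEnergy β q₀ p := by
    rw [genRho_sq hα, hs, div_pow, pow_mul, sq_abs, ← pow_mul, mul_pow, hyk]
    field_simp
  set ρ := genRho α (genSin α φ₁ / q₀.1) with hρdef
  rcases eq_or_ne ρ 0 with h0 | h0
  · have hz : p.2.1 = 0 ∧ p.2.2 = 0 := by
      rw [h0, vertEnergy] at hρ
      have h1 : 0 < q₀.2.1 ^ (2 * β) := by rw [pow_mul]; positivity
      have h2 : p.2.1 ^ 2 = 0 := by nlinarith [sq_nonneg p.2.1, sq_nonneg p.2.2]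
      have h3 : q₀.2.1 ^ (2 * β) * p.2.2 ^ 2 = 0 := by nlinarith [sq_nonneg p.2.1, sq_nonneg p.2.2]
      exact ⟨by simpa using h2, by simpa [h1.ne'] using h3⟩
    refine ⟨(φ₁, 0), ⟨hφ₁, le_rfl, by have := genPi_pos hβ; simp only; linarith⟩, ?_⟩
    ext <;> simp only [sphericalCovector, ← hρdef, h0, mul_zero, zero_mul, hc, hz.1, hz.2]
  · obtain ⟨η, hη⟩ := exists_genRho_eq hβ (p.2.2 / ρ)
    obtain ⟨φ₂, hφ₂, hc2, hs2⟩ := exists_genCos_genSin hβ (X := p.2.1 / ρ) (Y := q₀.2.1 * η) (by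
      rw [mul_pow, ← genRho_sq hβ η, hη]
      rw [vertEnergy] at hρ
      field_simp
      linarith)
    refine ⟨(φ₁, φ₂), ⟨hφ₁, hφ₂⟩, ?_⟩
    ext
    · exact hc
    · simp only [sphericalCovector, ← hρdef, hc2]; field_simp
    · simp only [sphericalCovector, ← hρdef, hs2]
      rw [mul_div_cancel_left₀ _ hy, hη]
      field_simp

theorem vertEnergy_sphericalCovector (hα : 1 ≤ α) (hβ : 1 ≤ β) (hy : q₀.2.1 ≠ 0) (φ : ℝ × ℝ) :
    vertEnergy β q₀ (sphericalCovector α β q₀ φ) = omegaOne α q₀ φ ^ (2 * α) := by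
  have h := genCos_sq_add hβ φ.2
  rw [vertEnergy, omegaOne, ← genRho_sq hα]
  simp only [sphericalCovector]
  rw [mul_pow, mul_pow, genRho_sq hβ, div_pow]
  field_simp
  linear_combination genRho α (genSin α φ.1 / q₀.1) ^ 2 * h

theorem sphericalCovector_pole_iff (hα : 1 ≤ α) (φ : ℝ × ℝ) :
    (sphericalCovector α β q₀ φ = (1, 0, 0) ∨ sphericalCovector α β q₀ φ = (-1, 0, 0)) ↔
      genSin α φ.1 = 0 := by
  have h := genCos_sq_add hα φ.1
  constructor
  · intro h1
    have h2 : genCos α φ.1 = 1 ∨ genCos α φ.1 = -1 :=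
      h1.imp (congrArg Prod.fst) (congrArg Prod.fst)
    have h3 : genCos α φ.1 ^ 2 = 1 := by rcases h2 with h2 | h2 <;> rw [h2] <;> norm_num
    rw [h3] at h
    exact pow_eq_zero_iff (show 2 * α ≠ 0 by omega) |>.1 (by linarith)
  · intro h1
    have h0 : genRho α (genSin α φ.1 / q₀.1) = 0 := by rw [genRho_eq_zero_iff, h1, zero_div]
    rw [h1, zero_pow (by omega), add_zero] at h
    simp only [sphericalCovector, h0, mul_zero, zero_mul, Prod.mk.injEq, and_true]
    exact mul_self_eq_one_iff.1 (by rw [← sq]; exact h)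

theorem sphericalCovector_w_eq_zero_iff (φ : ℝ × ℝ) :
    (sphericalCovector α β q₀ φ).2.2 = 0 ↔ omegaTwo α β q₀ φ = 0 := by
  simp only [sphericalCovector, omegaTwo, mul_eq_zero, genRho_eq_zero_iff]
  tauto

end Coordinates

section ConjugateTimes

variable {α β : ℕ} {q₀ : ℝ × ℝ × ℝ}

theorem differentiableAt_grushinExp_and_isConjugateTime_iff (hα : 1 ≤ α) (hβ : 1 ≤ β)
    (hx : q₀.1 ≠ 0) (hy : q₀.2.1 ≠ 0) (p : ℝ × ℝ × ℝ) (t : ℝ) :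
    DifferentiableAt ℝ (grushinExp α β q₀) (t • p) ∧ (IsConjugateTime α β q₀ p t ↔ 0 < t ∧
      (oscJacobian α q₀.1 (t * p.1) (t ^ 2 * vertEnergy β q₀ p) = 0 ∨
        oscJacobian β q₀.2.1 (oscInt α q₀.1 p.1 (vertEnergy β q₀ p) t * p.2.1)
          ((oscInt α q₀.1 p.1 (vertEnergy β q₀ p) t * p.2.2) ^ 2) = 0)) := by
  obtain ⟨L, hL, hsurj⟩ := exists_hasFDerivAt_grushinExp hα hβ hx hy (t • p)
  have hS := oscInt_mul (u := p.1) hα hx (vertEnergy_nonneg (β := β) q₀ p) t 1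
  rw [mul_one] at hS
  simp only [vertEnergy_smul, Prod.smul_fst, Prod.smul_snd, smul_eq_mul, ← mul_assoc,
    mul_comm _ t, hS] at hsurj
  refine ⟨hL.differentiableAt, ?_⟩
  rw [IsConjugateTime, hL.fderiv, hsurj, not_and_or, not_not, not_not]
  exact ⟨fun h => ⟨h.1, h.2.2⟩, fun h => ⟨h.1, hL.differentiableAt, h.2⟩⟩

/-- The phase data of the first oscillator of the geodesic with spherical coordinates `φ`. -/
theorem firstOscillator_data (hα : 1 ≤ α) (hβ : 1 ≤ β) (hx : q₀.1 ≠ 0) (hy : q₀.2.1 ≠ 0)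
    {φ : ℝ × ℝ} (hs : genSin α φ.1 ≠ 0) {t : ℝ} (ht : 0 < t) :
    0 < t ^ 2 * vertEnergy β q₀ (sphericalCovector α β q₀ φ) ∧
    (omegaOne α q₀ φ * t) ^ 2 = t ^ 2 * vertEnergy β q₀ (sphericalCovector α β q₀ φ) *
      (1 / omegaOne α q₀ φ) ^ (2 * α - 2) ∧ 1 / omegaOne α q₀ φ * genSin α φ.1 = q₀.1 ∧
    1 / omegaOne α q₀ φ * (omegaOne α q₀ φ * t) * genCos α φ.1 =
      t * (sphericalCovector α β q₀ φ).1 := by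
  have hω : omegaOne α q₀ φ ≠ 0 := div_ne_zero hs hx
  rw [vertEnergy_sphericalCovector hα hβ hy]
  refine ⟨?_, ?_, ?_, ?_⟩
  · rw [pow_mul]; positivity
  · obtain ⟨n, hn⟩ : ∃ n, 2 * α = n + 2 := ⟨2 * α - 2, by omega⟩
    rw [hn, Nat.add_sub_cancel, div_pow]
    field_simp
    ring
  · unfold omegaOne; field_simp
  · simp only [sphericalCovector]; field_simp

/-- The phase data of the second oscillator of the geodesic with spherical coordinates `φ`. -/
theorem secondOscillator_data (hβ : 1 ≤ β) (hy : q₀.2.1 ≠ 0)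
    {φ : ℝ × ℝ} (hω : omegaTwo α β q₀ φ ≠ 0) {σ : ℝ} (hσ : 0 < σ) :
    0 < (σ * (sphericalCovector α β q₀ φ).2.2) ^ 2 ∧
    (omegaTwo α β q₀ φ * σ) ^ 2 = (σ * (sphericalCovector α β q₀ φ).2.2) ^ 2 *
      (q₀.2.1 / genSin β φ.2) ^ (2 * β - 2) ∧ q₀.2.1 / genSin β φ.2 * genSin β φ.2 = q₀.2.1 ∧
    q₀.2.1 / genSin β φ.2 * (omegaTwo α β q₀ φ * σ) * genCos β φ.2 =
      σ * (sphericalCovector α β q₀ φ).2.1 := by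
  have hw : (sphericalCovector α β q₀ φ).2.2 ≠ 0 :=
    fun h => hω (sphericalCovector_w_eq_zero_iff φ |>.1 h)
  have hs : genSin β φ.2 ≠ 0 := by
    intro h; apply hω; simp [omegaTwo, h]
  refine ⟨by positivity, ?_, ?_, ?_⟩
  · simp only [sphericalCovector, omegaTwo, mul_pow, genRho_sq hβ]
    obtain ⟨n, hn⟩ : ∃ n, 2 * β = n + 2 := ⟨2 * β - 2, by omega⟩
    rw [hn, Nat.add_sub_cancel, div_pow, div_pow, div_pow]
    field_simp
    ring
  · field_simp
  · simp only [sphericalCovector, omegaTwo]; field_simp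

theorem tauTwoSet_eq (hα : 1 ≤ α) (hβ : 1 ≤ β) (hx : q₀.1 ≠ 0) (hy : q₀.2.1 ≠ 0) (φ : ℝ × ℝ) :
    tauTwoSet α β q₀ φ = {t | 0 < t ∧ |omegaTwo α β q₀ φ| *
      oscInt α q₀.1 (sphericalCovector α β q₀ φ).1
        (vertEnergy β q₀ (sphericalCovector α β q₀ φ)) t = genPi β} := by
  unfold tauTwoSet
  rw [grushinGeodesic_eq_path hα hβ hx hy]
  rfl

theorem exists_isLeast_level {f : ℝ → ℝ} (hf : Continuous f) {c t₁ : ℝ} (h0 : f 0 < c)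
    (ht₁ : 0 < t₁) (h1 : c ≤ f t₁) : ∃ t, IsLeast {t | 0 < t ∧ f t = c} t ∧ t ≤ t₁ := by
  have hset : {t | 0 < t ∧ f t = c} = Ici 0 ∩ f ⁻¹' {c} := by
    ext t
    constructor
    · exact fun h => ⟨h.1.le, h.2⟩
    · rintro ⟨h, h'⟩
      refine ⟨lt_of_le_of_ne h ?_, h'⟩
      rintro rfl
      exact h0.ne h'
  have hcl : IsClosed {t | 0 < t ∧ f t = c} := by
    rw [hset]; exact isClosed_Ici.inter (isClosed_singleton.preimage hf)
  obtain ⟨s, hs, hsc⟩ := intermediate_value_Icc ht₁.le hf.continuousOn ⟨h0.le, h1⟩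
  have hmem : s ∈ {t | 0 < t ∧ f t = c} := by rw [hset]; exact ⟨hs.1, hsc⟩
  have hl := hcl.isLeast_csInf ⟨s, hmem⟩ ⟨0, fun t ht => ht.1.le⟩
  exact ⟨_, hl, (hl.2 hmem).trans hs.2⟩

theorem tauTwo_eq_of_isLeast {φ : ℝ × ℝ} (hw : (sphericalCovector α β q₀ φ).2.2 ≠ 0) {t : ℝ}
    (h : IsLeast (tauTwoSet α β q₀ φ) t) : tauTwo α β q₀ φ = t := by
  rw [tauTwo, if_neg hw]
  refine IsLeast.csInf_eq ⟨⟨t, h.1, rfl⟩, ?_⟩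
  rintro _ ⟨s, hs, rfl⟩
  exact EReal.coe_le_coe_iff.2 (h.2 hs)

theorem eq_conjugateTime {p : ℝ × ℝ × ℝ} {M : EReal}
    (h : ∀ t : ℝ, 0 < t → (t : EReal) < M → ¬ IsConjugateTime α β q₀ p t)
    (h' : M = ⊤ ∨ ∃ T : ℝ, M = T ∧ IsConjugateTime α β q₀ p T) : M = conjugateTime α β q₀ p := by
  refine le_antisymm (le_sInf ?_) ?_
  · rintro _ ⟨t, ht, rfl⟩
    by_contra hlt
    exact h t ht.1 (not_le.1 hlt) ht
  · rcases h' with rfl | ⟨T, rfl, hT⟩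
    · exact le_top
    · exact sInf_le ⟨T, hT, rfl⟩

end ConjugateTimes

end

open Set Filter Topology

theorem mainTheorem9 (α β : ℕ) (hα : 1 ≤ α) (hβ : 1 ≤ β)
    (q₀ : ℝ × ℝ × ℝ) (hq₀ : IsRiemannianPoint α β q₀)
    (l₀ : ℝ × ℝ × ℝ) (hl₀ : grushinHamiltonian α β q₀ l₀ = 1 / 2) :
    -- the geodesic with initial covector `l₀` exists for all times and is `t ↦ exp_{q₀}(t l₀)`
    IsGrushinGeodesic α β q₀ l₀ (grushinGeodesic α β q₀ l₀) ∧
    (∀ t : ℝ, grushinExp α β q₀ (t • l₀) = grushinGeodesic α β q₀ l₀ t) ∧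
    -- `l₀` has generalized spherical coordinates
    (∃ φ ∈ sphericalDomain α β, sphericalCovector α β q₀ φ = l₀) ∧
    ∀ φ ∈ sphericalDomain α β, sphericalCovector α β q₀ φ = l₀ →
      -- the minimum that defines `τ₂` is attained
      (l₀.2.2 ≠ 0 → ∃ t, IsLeast (tauTwoSet α β q₀ φ) t) ∧
      -- no conjugate time before `τ = min {τ₁, τ₂}`
      (∀ t : ℝ, 0 < t → (t : EReal) < min (tauOne α β q₀ φ) (tauTwo α β q₀ φ) →
        DifferentiableAt ℝ (grushinExp α β q₀) (t • l₀) ∧ ¬ IsConjugateTime α β q₀ l₀ t) ∧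
      -- cases in which `τ` is the conjugate time
      ((φ.1 = genPi α / 2 ∧ tauOne α β q₀ φ ≤ tauTwo α β q₀ φ) ∨
        (tauTwo α β q₀ φ ≤ tauOne α β q₀ φ ∧
          (φ.2 = genPi β / 2 ∨ φ.2 = 3 * genPi β / 2)) →
        min (tauOne α β q₀ φ) (tauTwo α β q₀ φ) = conjugateTime α β q₀ l₀) := by
  obtain ⟨hx, hy⟩ := hq₀.ne_zero hα hβ
  have hπα := genPi_pos hα
  have hπβ := genPi_pos hβ
  refine ⟨?_, grushinExp_smul hα hβ hx hy l₀, exists_sphericalCovector_eq hα hβ hx hy hl₀, ?_⟩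
  · rw [grushinGeodesic_eq_path hα hβ hx hy]
    exact isGrushinGeodesic_grushinPath hα hβ hx hy l₀
  rintro φ - rfl
  have hconj := differentiableAt_grushinExp_and_isConjugateTime_iff hα hβ hx hy
    (sphericalCovector α β q₀ φ)
  have hκ := vertEnergy_nonneg (β := β) q₀ (sphericalCovector α β q₀ φ)
  set σ := oscInt α q₀.1 (sphericalCovector α β q₀ φ).1
    (vertEnergy β q₀ (sphericalCovector α β q₀ φ)) with hσdef
  have hset : tauTwoSet α β q₀ φ = {t | 0 < t ∧ |omegaTwo α β q₀ φ| * σ t = genPi β} :=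
    tauTwoSet_eq hα hβ hx hy φ
  have hσpos : ∀ t, 0 < t → 0 < σ t := fun t ht => oscInt_pos hα hx hκ ht
  have hσc : Continuous (fun t => |omegaTwo α β q₀ φ| * σ t) :=
    continuous_const.mul (continuous_iff_continuousAt.2 fun t => (hasDerivAt_oscInt hα hκ t).continuousAt)
  have hσ0 : |omegaTwo α β q₀ φ| * σ 0 < genPi β := by
    simp [hσdef, oscInt, hπβ]
  have hwω := sphericalCovector_w_eq_zero_iff (α := α) (β := β) (q₀ := q₀) φ
  have hpole := sphericalCovector_pole_iff (β := β) (q₀ := q₀) hα φ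
  have hleast : (sphericalCovector α β q₀ φ).2.2 ≠ 0 → ∃ t, IsLeast (tauTwoSet α β q₀ φ) t := by
    intro hw
    have hω2 : 0 < |omegaTwo α β q₀ φ| := abs_pos.2 (hwω.not.1 hw)
    have hκpos : 0 < vertEnergy β q₀ (sphericalCovector α β q₀ φ) := by
      have : 0 < q₀.2.1 ^ (2 * β) := by rw [pow_mul]; positivity
      unfold vertEnergy
      positivity
    obtain ⟨t₁, ht₁, h1⟩ := exists_le_oscInt (u := (sphericalCovector α β q₀ φ).1) hα hx hκpos
      (genPi β / |omegaTwo α β q₀ φ|)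
    rw [div_le_iff₀' hω2] at h1
    obtain ⟨t, ht, -⟩ := exists_isLeast_level hσc hσ0 ht₁ h1
    rw [hset]
    exact ⟨t, ht⟩
  have hreg : ∀ t : ℝ, 0 < t → (t : EReal) < min (tauOne α β q₀ φ) (tauTwo α β q₀ φ) →
      ¬ IsConjugateTime α β q₀ (sphericalCovector α β q₀ φ) t := by
    intro t ht hlt
    obtain ⟨hlt1, hlt2⟩ := lt_min_iff.1 hlt
    rw [(hconj t).2]
    rintro ⟨-, hJ | hJ⟩
    · by_cases hs : genSin α φ.1 = 0
      · rw [vertEnergy_sphericalCovector hα hβ hy, omegaOne, hs, zero_div, zero_pow (by omega),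
          mul_zero] at hJ
        exact oscJacobian_zero_ne_zero hα hx hJ
      · obtain ⟨d1, d2, d3, d4⟩ := firstOscillator_data hα hβ hx hy hs ht
        rw [← d3, ← d4] at hJ
        rw [tauOne, if_neg (hpole.not.2 hs), EReal.coe_lt_coe_iff] at hlt1
        have hω : 0 < |omegaOne α q₀ φ| := abs_pos.2 (div_ne_zero hs hx)
        rw [lt_div_iff₀ hω] at hlt1
        refine oscJacobian_ne_zero hα d1 d2 (by rwa [d3]) ?_ ?_ hJ
        · rw [abs_mul, abs_of_pos ht]; positivity
        · rw [abs_mul, abs_of_pos ht, mul_comm]; exact hlt1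
    · by_cases hω2 : omegaTwo α β q₀ φ = 0
      · rw [hwω.2 hω2, mul_zero, zero_pow two_ne_zero] at hJ
        exact oscJacobian_zero_ne_zero hβ hy hJ
      · have hlt : |omegaTwo α β q₀ φ| * σ t < genPi β := by
          by_contra hge
          obtain ⟨s, hs, hst⟩ := exists_isLeast_level hσc hσ0 ht (not_lt.1 hge)
          rw [← hset] at hs
          rw [tauTwo_eq_of_isLeast (hwω.not.2 hω2) hs, EReal.coe_lt_coe_iff] at hlt2
          linarith
        obtain ⟨d1, d2, d3, d4⟩ := secondOscillator_data hβ hy hω2 (hσpos t ht)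
        rw [← d4] at hJ
        have hne := oscJacobian_ne_zero hβ d1 d2 (by rwa [d3])
          (by rw [abs_mul, abs_of_pos (hσpos t ht)]
              exact mul_pos (abs_pos.2 hω2) (hσpos t ht))
          (by rw [abs_mul, abs_of_pos (hσpos t ht)]; exact hlt)
        rw [d3] at hne
        exact hne hJ
  refine ⟨hleast, fun t ht hlt => ⟨(hconj t).1, hreg t ht hlt⟩, fun hcase => ?_⟩
  refine eq_conjugateTime hreg ?_
  rcases hcase with ⟨hφ, hle⟩ | ⟨hle, hφ⟩
  · right
    have hs : genSin α φ.1 ≠ 0 := by rw [hφ, genSin_half_pi hα]; exact one_ne_zero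
    have hω : 0 < |omegaOne α q₀ φ| := abs_pos.2 (div_ne_zero hs hx)
    have hT : 0 < genPi α / |omegaOne α q₀ φ| := by positivity
    refine ⟨genPi α / |omegaOne α q₀ φ|, ?_, ?_⟩
    · rw [min_eq_left hle, tauOne, if_neg (hpole.not.2 hs)]
    · rw [(hconj _).2]
      refine ⟨hT, Or.inl ?_⟩
      obtain ⟨d1, d2, d3, d4⟩ := firstOscillator_data (β := β) hα hβ hx hy hs hT
      have := oscJacobian_eq_zero hα d1 d2 (by rwa [d3])
        (by rw [abs_mul, abs_of_pos hT]; field_simp) (by rw [hφ, genCos_half_pi hα])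
      rwa [d3, d4] at this
  · rw [min_eq_right hle]
    by_cases hw : (sphericalCovector α β q₀ φ).2.2 = 0
    · left
      rw [tauTwo, if_pos hw]
    · right
      obtain ⟨T, hT⟩ := hleast hw
      refine ⟨T, tauTwo_eq_of_isLeast hw hT, ?_⟩
      have hT' := hT.1
      rw [hset] at hT'
      obtain ⟨hTpos, hTeq⟩ := hT'
      rw [(hconj _).2]
      refine ⟨hTpos, Or.inr ?_⟩
      obtain ⟨d1, d2, d3, d4⟩ := secondOscillator_data hβ hy (hwω.not.1 hw) (hσpos T hTpos)
      have hcos : genCos β φ.2 = 0 := by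
        rcases hφ with h | h
        · rw [h, genCos_half_pi hβ]
        · rw [h, show 3 * genPi β / 2 = genPi β / 2 + genPi β by ring, genCos_antiperiodic hβ,
            genCos_half_pi hβ, neg_zero]
      have := oscJacobian_eq_zero hβ d1 d2 (by rwa [d3])
        (by rw [abs_mul, abs_of_pos (hσpos T hTpos)]; exact hTeq) hcos
      rwa [d3, d4] at this
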